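/- **Setting.** Let $F$ be a $p$-adic field with ring of integers $\mathcal O_F$, uniformizer $\pi_F$, residue field of cardinality $q$, absolute value normalised by $|\pi_F|=q^{-1}$, and valuation $v=-\log_q|\cdot|$, extended to an algebraic closure $\bar F$. Let $n,\alpha,s$ be integers with $\alpha\ge 1$ and $1\le s\le n$. For a partition (ordered) $(m_1,\dots,m_l)$ of an integer $m\geq 1$ into positive integers let $P=MN\subset GL_m$ be the corresponding standard (block upper triangular) parabolic subgroup, with $M=GL_{m_1}\times\cdots\times GL_{m_l}$. For a locally constant compactly supported function $f$ on $GL_m(F)$ its constant term is the function on $M(F)$ $$f^{(P)}(x)=\delta_P(x)^{1/2}\int_{N(F)}f(xu)\,du,\qquad \delta_P(x)=|\det(\mathrm{Ad}(x)\mid \mathrm{Lie}\,N)|,$$ where $N(\mathcal O_F)$ has measure $1$. The Satake transform of a $GL_m(\mathcal O_F)$-bi-invariant $f$ is its constant term along the upper triangular Borel subgroup, viewed as an element of $\mathbb C[X_1^{\pm1},\dots,X_m^{\pm1}]$, where $X^\mu$ corresponds to the characteristic function of $\mathrm{diag}(\pi_F^{\mu_1},\dots,\pi_F^{\mu_m})\,T(\mathcal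 O_F)$ on the diagonal torus $T(F)$. For integers $m\ge 1$ and $r\ge0$ let $f_{m\alpha r}$ be the compactly supported $GL_m(\mathcal O_F)$-bi-invariant function on $GL_m(F)$ with Satake transform $$q^{\alpha r(m-r)/2}\sum_{I\subset\{1,\dots,m\},\ |I|=r}\ \prod_{i\in I}X_i^{\alpha}.$$ For $P=MN\subset GL_n$ corresponding to a partition $(m_1,\dots,m_l)$ of $n$, define functions on $M(F)$: * $C_c^{M}$ is the characteristic function of the set of $(g_1,\dots,g_l)\in M(F)$ such that, for each $i$, all eigenvalues of $g_i$ in $\bar F$ have the same absolute value; * $\chi^{GL_n}_M$ is the characteristic function of the set of $(g_1,\dots,g_l)\in M(F)$ with $\frac{v(\det g_1)}{m_1}>\frac{v(\det g_2)}{m_2}>\cdots>\frac{v(\det g_l)}{m_l}$. For $g\in GL_n(F)$ let $\Phi(g)\in\mathbb R^n$ be the tuple of the valuations of the eigenvalues of $g$ (with multiplicity) in decreasing order. For $b\in\mathbb R^n$ with $b_1\ge\cdots\ge b_n$ let $C_b$ be the characteristic function of $\{g\in GL_n(F):\Phi(g)=tb\text{ for some real }t>0\}$, which we also restrict to $M(F)\subset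 GL_n(F)$. Fix a partition $(n_1,\dots,n_k)$ of $n$ and real numbers $\lambda_1>\cdots>\lambda_k$ such that $s_i:=\lambda_in_i$ is a non-negative integer for every $i$ and $\sum_i s_i=s$. Put $\lambda=(\lambda_1^{n_1},\dots,\lambda_k^{n_k})\in\mathbb R^n$ (each $\lambda_i$ repeated $n_i$ times), let $P_\lambda=M_\lambda N_\lambda$ be the standard parabolic subgroup corresponding to $(n_1,\dots,n_k)$, and put $$C(n_i,s_i)=\frac{s(n-s)}2-\sum_{i=1}^k\frac{s_i(n_i-s_i)}2 .$$ **Proposition 3.3.** 1. If $P=MN\subset GL_n$ is a standard parabolic subgroup with $P\ne P_\lambda$, then the function $C_c^{M}\,C_\lambda\,\chi^{GL_n}_{M}\,f_{n\alpha s}^{(P)}$ on $M(F)$ is $0$. 2. The function $C_c^{M_\lambda}\,C_\lambda\,\chi^{GL_n}_{M_\lambda}\,f_{n\alpha s}^{(P_\lambda)}$ on $M_\lambda(F)$ is locally constant with compact support, and it equals $$q^{\alpha C(n_i,s_i)}\;C_c^{M_\lambda}\,(f_{n_1\alpha s_1}\otimes\cdots\otimes f_{n_k\alpha s_k}).$$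 -/

import Mathlib

open scoped MatrixGroups
open MeasureTheory

noncomputable section

namespace GLTrunc

/-! ### The field, its normalised absolute value and valuation -/

section Field

variable (F : Type*) [NontriviallyNormedField F] [IsUltrametricDist F]

/-- The ring of integers of `F`, i.e. the elements of norm at most `1`. -/
def integers : ValuationSubring F := (NormedField.valuation (K := F)).valuationSubring

/-- The number `q` of elements of the residue field. -/
def resCard : ℕ := Nat.card (IsLocalRing.ResidueField (integers F))

variable {F}

/-- `ϖ` is a uniformizer (an element of largest norm among those of norm `< 1`), and the norm of
`F` is the normalised absolute value, `‖ϖ‖ = q⁻¹`. -/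
structure IsNormalizedUniformizer (ϖ : F) : Prop where
  norm_eq : ‖ϖ‖ = (resCard F : ℝ)⁻¹
  norm_le : ∀ x : F, ‖x‖ < 1 → ‖x‖ ≤ ‖ϖ‖

/-- The valuation `x ↦ -log_q |x|` of a nonzero element of `F`; it is `1` at a uniformizer when the
norm is normalised. -/
def val (x : F) : ℝ := -Real.logb (resCard F) ‖x‖

/-- The extension of `val` to an algebraic closure of `F`, through the unique extension of the
absolute value of `F`. -/
def valBar (x : AlgebraicClosure F) : ℝ :=
  -Real.logb (resCard F) (spectralNorm F (AlgebraicClosure F) x)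

end Field

/-- The compact set with nonempty interior `{x | ‖x‖ ≤ 1}`, the ring of integers. -/
def unitBall (F : Type*) [NontriviallyNormedField F] [ProperSpace F] :
    TopologicalSpace.PositiveCompacts F where
  carrier := Metric.closedBall 0 1
  isCompact' := isCompact_closedBall 0 1
  interior_nonempty' :=
    ⟨0, Metric.ball_subset_interior_closedBall (Metric.mem_ball_self one_pos)⟩

/-- The additive Haar measure on `F` that gives the ring of integers measure `1`. -/
def haarF (F : Type*) [NontriviallyNormedField F] [ProperSpace F] [MeasurableSpace F]
    [BorelSpace F] : Measure F :=
  Measure.addHaarMeasure (unitBall F)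

/-! ### Hecke algebras -/

/-- Membership in the Hecke algebra: locally constant with compact support. -/
structure IsHecke {G : Type*} [TopologicalSpace G] (f : G → ℂ) : Prop where
  locConst : IsLocallyConstant f
  compactSupport : HasCompactSupport f

/-- The hyperspecial maximal compact subgroup `GL_n(𝒪_F)` of `GL_n(F)`. -/
def maxCompact (F : Type*) [NontriviallyNormedField F] [IsUltrametricDist F] (n : ℕ) :
    Subgroup (GL (Fin n) F) :=
  (Matrix.GeneralLinearGroup.map (n := Fin n) (algebraMap (integers F) F)).range

/-- Membership in the unramified Hecke algebra of `GL_n(F)`. -/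
structure IsUnramified {F : Type*} [NontriviallyNormedField F] [IsUltrametricDist F] {n : ℕ}
    (f : GL (Fin n) F → ℂ) : Prop extends IsHecke f where
  biInvariant : ∀ k₁ ∈ maxCompact F n, ∀ k₂ ∈ maxCompact F n, ∀ g, f (k₁ * g * k₂) = f g

/-! ### Standard parabolic subgroups

The standard (block upper triangular) parabolic subgroups `P = M N` of `GL_n` correspond to the
partitions `(n_1, …, n_k)` of `n`, i.e. to the compositions `c` of `n`. -/

section Parabolic

variable {F : Type*} [NontriviallyNormedField F] {n : ℕ}

/-- The Levi subgroup `M(F) = GL_{n_1}(F) × ⋯ × GL_{n_k}(F)`. -/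
abbrev Levi (F : Type*) [NontriviallyNormedField F] {n : ℕ} (c : Composition n) : Type _ :=
  ∀ i : Fin c.length, GL (Fin (c.blocksFun i)) F

/-- The block diagonal embedding `M(F) → GL_n(F)`. -/
def leviEmb (c : Composition n) : Levi F c →* GL (Fin n) F :=
  (Units.map
    ((Matrix.reindexAlgEquiv F F c.blocksFinEquiv).toRingEquiv.toRingHom.comp
      (Matrix.blockDiagonal'RingHom (fun i => Fin (c.blocksFun i)) F)).toMonoidHom).comp
    MulEquiv.piUnits.symm.toMonoidHom

/-- The matrix positions strictly above the diagonal blocks. -/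
abbrev UpperPos (c : Composition n) : Type :=
  {x : Fin n × Fin n // c.index x.1 < c.index x.2}

/-- The matrix `1 + X`, where `X` has the entries `x` above the diagonal blocks. -/
def unipMatrix (c : Composition n) (x : UpperPos c → F) : Matrix (Fin n) (Fin n) F :=
  1 + Matrix.of fun a b => if h : c.index a < c.index b then x ⟨(a, b), h⟩ else 0

theorem det_unipMatrix (c : Composition n) (x : UpperPos c → F) : (unipMatrix c x).det = 1 := by
  have hidx : ∀ a b : Fin n, c.index a < c.index b → a < b := by
    intro a b h
    have h1 : c.sizeUpTo (c.index a + 1) ≤ c.sizeUpTo (c.index b) :=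
      c.monotone_sizeUpTo h
    have h2 := c.lt_sizeUpTo_index_succ a
    have h3 := c.sizeUpTo_index_le b
    exact Fin.lt_def.2 (lt_of_lt_of_le h2 (h1.trans h3))
  rw [Matrix.det_of_isUpperTriangular]
  · simp [unipMatrix]
  · intro a b h
    have hne : a ≠ b := fun e => by simp [e] at h
    have hn : ¬ c.index a < c.index b := fun h' => lt_asymm (hidx a b h') h
    simp [unipMatrix, Matrix.one_apply_ne hne, hn]

/-- The parametrisation of the unipotent radical `N(F)` by its matrix entries. -/
def unip (c : Composition n) (x : UpperPos c → F) : GL (Fin n) F :=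
  Matrix.GeneralLinearGroup.mkOfDetNeZero (unipMatrix c x)
    (by rw [det_unipMatrix]; exact one_ne_zero)

/-- The matrix of `X ↦ m X m⁻¹` on the Lie algebra of `N`, in the basis of elementary matrices. -/
def adMatrix (c : Composition n) (m : Levi F c) : Matrix (UpperPos c) (UpperPos c) F :=
  Matrix.of fun x y => (leviEmb c m).val x.1.1 y.1.1 * (leviEmb c m)⁻¹.val y.1.2 x.1.2

/-- The modular character `δ_P(m) = |det(m, Lie N)|` (for a normalised norm). -/
def modular (c : Composition n) (m : Levi F c) : ℝ := ‖(adMatrix c m).det‖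

/-- The constant term `f^{(P)}(m) = δ_P(m)^{1/2} ∫_{N(F)} f(m n) dn`, where the Haar measure of
`N(F)`, i.e. the product measure in the matrix entries, gives `N(𝒪_F)` measure `1`. -/
def constantTerm [ProperSpace F] [MeasurableSpace F] [BorelSpace F] (c : Composition n)
    (f : GL (Fin n) F → ℂ) (m : Levi F c) : ℂ :=
  (Real.sqrt (modular c m) : ℂ) *
    ∫ x : UpperPos c → F, f (leviEmb c m * unip c x) ∂(Measure.pi fun _ => haarF F)

/-- The diagonal torus inside the Levi subgroup `M(F)`. For the composition `(1, …, 1)` this is an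
isomorphism onto the Levi subgroup of the Borel subgroup. -/
def torusToLevi (c : Composition n) (t : Fin n → Fˣ) : Levi F c := fun i =>
  Units.map (Matrix.diagonalRingHom (Fin (c.blocksFun i)) F).toMonoidHom
    (MulEquiv.piUnits.symm fun j => t (c.embedding i j))

/-- The Satake transform: the constant term along the upper triangular Borel subgroup, as a
function on the diagonal torus. -/
def satake [ProperSpace F] [MeasurableSpace F] [BorelSpace F] (f : GL (Fin n) F → ℂ)
    (t : Fin n → Fˣ) : ℂ :=
  constantTerm (Composition.ones n) f (torusToLevi (Composition.ones n) t)

end Parabolic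

/-! ### Kottwitz functions -/

section KottwitzFunction

/-- The Laurent polynomial ring `ℂ[X_1^{±1}, …, X_n^{±1}]`. -/
abbrev Laurent (n : ℕ) : Type := AddMonoidAlgebra ℂ (Fin n → ℤ)

/-- The variable `X_k`. -/
def X {n : ℕ} (k : Fin n) : Laurent n := AddMonoidAlgebra.single (Pi.single k 1) 1

variable {F : Type*} [NontriviallyNormedField F]

open Classical in
/-- The isomorphism from the Laurent polynomials to the unramified Hecke algebra of the diagonal
torus `T(F)`: the monomial `X^μ` goes to the characteristic function of `ϖ^μ T(𝒪_F)`. -/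
def Laurent.toFun {n : ℕ} (ϖ : F) (p : Laurent n) (t : Fin n → Fˣ) : ℂ :=
  p.coeff.sum fun μ a => if ∀ k, ‖(t k : F)‖ = ‖ϖ‖ ^ μ k then a else 0

variable [IsUltrametricDist F]

/-- The symmetric Laurent polynomial `q^{α s (n - s) / 2} ∑_{|I| = s} (X^I)^α`. -/
def kottwitzPoly (F : Type*) [NontriviallyNormedField F] [IsUltrametricDist F] (n α s : ℕ) :
    Laurent n :=
  (((resCard F : ℝ) ^ ((α : ℝ) * s * ((n : ℝ) - s) / 2) : ℝ) : ℂ) •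
    ∑ I ∈ (Finset.univ : Finset (Fin n)).powersetCard s, (∏ i ∈ I, X i) ^ α

/-- `f` is the function `f_{nαs}`: the element of the unramified Hecke algebra of `GL_n(F)` whose
Satake transform is `q^{α s (n - s) / 2} ∑_{|I| = s} (X^I)^α`. -/
structure IsKottwitzFunction [ProperSpace F] [MeasurableSpace F] [BorelSpace F] (ϖ : F)
    (n α s : ℕ) (f : GL (Fin n) F → ℂ) : Prop where
  unramified : IsUnramified f
  satake_eq : satake f = (kottwitzPoly F n α s).toFun ϖ

end KottwitzFunction

/-! ### Truncations -/

section Truncation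

variable {F : Type*} [NontriviallyNormedField F]

/-- The eigenvalues, with multiplicity, in an algebraic closure of `F`. -/
def eigenvalues {n : ℕ} (g : GL (Fin n) F) : Multiset (AlgebraicClosure F) :=
  g.val.charpoly.aroots (AlgebraicClosure F)

/-- The set `Ω_{M,c}` of compact elements of `M(F)`: in each block, all eigenvalues have the same
absolute value. -/
def compactElements (F : Type*) [NontriviallyNormedField F] {n : ℕ} (c : Composition n) :
    Set (Levi F c) :=
  {m | ∀ i, ∀ x ∈ eigenvalues (m i), ∀ y ∈ eigenvalues (m i),
    spectralNorm F (AlgebraicClosure F) x = spectralNorm F (AlgebraicClosure F) y}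

variable [IsUltrametricDist F] {n : ℕ}

/-- The tuple `Φ(g)` of the valuations of the eigenvalues of `g`, in decreasing order. -/
def slopes (g : GL (Fin n) F) : List ℝ :=
  ((eigenvalues g).map valBar).sort (· ≥ ·)

/-- The set `Ω_b` of the `g` with `Φ(g) = t b` for some real `t > 0`. -/
def slopeSet (F : Type*) [NontriviallyNormedField F] [IsUltrametricDist F] {n : ℕ}
    (b : Fin n → ℝ) : Set (GL (Fin n) F) :=
  {g | ∃ t : ℝ, 0 < t ∧ slopes g = List.ofFn fun a => t * b a}

/-- The set of `m = (m_1, …, m_k)` in `M(F)` on which all roots occurring in the Lie algebra of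
`N` are positive, i.e. `v(det m_1) / n_1 > ⋯ > v(det m_k) / n_k`. -/
def positiveChamber (F : Type*) [NontriviallyNormedField F] [IsUltrametricDist F] {n : ℕ}
    (c : Composition n) : Set (Levi F c) :=
  {m | ∀ i j, i < j →
    val (m j).val.det / c.blocksFun j < val (m i).val.det / c.blocksFun i}

/-- `C_c^{M(F)}`, the characteristic function of the compact elements. -/
def charCompact (c : Composition n) : Levi F c → ℂ := (compactElements F c).indicator 1

/-- `C_b`, the characteristic function of `Ω_b`. -/
def charSlope (b : Fin n → ℝ) : GL (Fin n) F → ℂ := (slopeSet F b).indicator 1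

/-- `χ^{GL_n}_M`, the characteristic function of the positive chamber. -/
def charPositive (c : Composition n) : Levi F c → ℂ := (positiveChamber F c).indicator 1

/-- The function `C_c^{M(F)} C_b χ^{GL_n}_M f^{(P)}` on `M(F)`, where `P = M N` is the standard
parabolic subgroup given by `c`. -/
def truncation [ProperSpace F] [MeasurableSpace F] [BorelSpace F] (c : Composition n)
    (b : Fin n → ℝ) (f : GL (Fin n) F → ℂ) (m : Levi F c) : ℂ :=
  charCompact c m * charSlope b (leviEmb c m) * charPositive c m * constantTerm c f m

/-- The vector `(λ_1^{n_1}, …, λ_k^{n_k})`, in which `λ_i` is repeated `n_i` times. -/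
def repeatVec (c : Composition n) (lam : Fin c.length → ℝ) : Fin n → ℝ := fun a => lam (c.index a)

/-- The constant `C(n_i, s_i) = s (n - s) / 2 - ∑ s_i (n_i - s_i) / 2`. -/
def constC (c : Composition n) (s : ℕ) (si : Fin c.length → ℕ) : ℝ :=
  (s : ℝ) * ((n : ℝ) - s) / 2 - ∑ i, (si i : ℝ) * ((c.blocksFun i : ℝ) - si i) / 2

end Truncation

end GLTrunc

end

set_option linter.unusedSectionVars false

/-! Write a compact element of `M` as `m = (m_1, …, m_l)`. All eigenvalues of `m_i` have the same
absolute value, so they all have valuation `v(det m_i) / n_i`, the slope of the block. The chamber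
condition says that these slopes strictly decrease, so `Φ(m)` is the list of slopes repeated
according to the block sizes. If this list is `tλ` with `t > 0`, the places where it drops determine
the composition; hence `P = P_λ`, which is the vanishing statement. For `P = P_λ` the slopes are
`tλ_i`. The constant term lives on `|det m| = |ϖ|^(αs)`, and `s > 0`, so `t = α`: the truncation is
the restriction of `C_c^M f^{(P)}` to the open set where `v(det m_i) = α s_i` for all `i`.

It remains to identify `f^{(P)}` on that set (`IsKottwitzFunction.constantTerm_eq`). By transitivity
of constant terms (`integral_constantTerm`), the Satake transform of `f^{(P)}` on `M` is that of `f`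
on `GL_n`, which is `q^(αs(n-s)/2)` on diagonal matrices with `s` entries of valuation `α` and the
others units, and `0` elsewhere. Restricting by block determinants commutes with integration over
unipotents, which have determinant `1`. It keeps the terms with exactly `s_i` entries of valuation
`α` in block `i`, and these form the product of the transforms of the `f_{n_i α s_i}`, up to the
power of `q`. Injectivity of the Satake transform on bi-invariant functions on `M` concludes
(`eq_zero_of_integral_eq_zero`).

Injectivity rests on the triangularity of the transform. If `t u` is upper triangular with diagonal
`t`, its elementary divisors are lexicographically at least `t`, with equality only for integral `u`
(`exists_maxCompactRel_diagGL_of_upper`). At a lexicographically maximal `t` in the support, the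
integral over `u` therefore reduces to the value at `t`.

Local constancy follows because the compact elements form a clopen set: they are cut out by
nonarchimedean inequalities between coefficients of characteristic polynomials
(`eigenvalues_eq_norm_iff`). -/

namespace GLTrunc

/-! ### Diagonal matrices -/

section Diagonal

variable {F : Type*} [NontriviallyNormedField F] {n : ℕ}

/-- The diagonal matrix with entries `t`. -/
def diagGL (t : Fin n → Fˣ) : GL (Fin n) F :=
  Units.map (Matrix.diagonalRingHom (Fin n) F).toMonoidHom (MulEquiv.piUnits.symm t)

@[simp] theorem diagGL_val (t : Fin n → Fˣ) :
    (diagGL t).val = Matrix.diagonal fun a => (t a : F) := rfl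

theorem diagGL_inv (t : Fin n → Fˣ) : (diagGL t)⁻¹ = diagGL fun a => (t a)⁻¹ := by
  refine inv_eq_of_mul_eq_one_left ?_
  ext a b
  by_cases h : a = b <;> simp [h]

end Diagonal

/-! ### Integral matrices and the maximal compact subgroup -/

section IntegralMatrices

variable {F : Type*} [NontriviallyNormedField F] [IsUltrametricDist F]

theorem mem_integers_iff {x : F} : x ∈ integers F ↔ ‖x‖ ≤ 1 := by
  rw [integers, Valuation.mem_valuationSubring_iff, NormedField.valuation_apply]
  exact_mod_cast Iff.rfl

theorem isUnit_integers_iff {x : integers F} : IsUnit x ↔ ‖(x : F)‖ = 1 := by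
  constructor
  · rintro ⟨u, rfl⟩
    have h1 := mem_integers_iff.1 (u : integers F).2
    have h2 := mem_integers_iff.1 ((u⁻¹ : (integers F)ˣ) : integers F).2
    have h3 : ((u : integers F) : F) * ((u⁻¹ : (integers F)ˣ) : integers F) = 1 := by
      rw [← MulMemClass.coe_mul, Units.mul_inv]; rfl
    have h4 := congrArg norm h3
    rw [norm_mul, norm_one] at h4
    nlinarith [norm_nonneg ((u : integers F) : F)]
  · intro h
    have hx : (x : F) ≠ 0 := fun h0 => by simp [h0] at h
    refine IsUnit.of_mul_eq_one ⟨(x : F)⁻¹, mem_integers_iff.2 (by simp [h])⟩ ?_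
    ext
    simp [hx]

theorem resCard_ne_one : resCard F ≠ 1 := by
  intro h
  have := (Nat.card_eq_one_iff_unique.1 h).1
  exact not_subsingleton (IsLocalRing.ResidueField (integers F)) this

/-- The matrix over the ring of integers underlying a matrix with integral entries. -/
def integralMatrix {m : Type*} (A : Matrix m m F) (hA : ∀ a b, ‖A a b‖ ≤ 1) :
    Matrix m m (integers F) :=
  Matrix.of fun a b => ⟨A a b, mem_integers_iff.2 (hA a b)⟩

theorem coe_det_integralMatrix {m : Type*} [Fintype m] [DecidableEq m] (A : Matrix m m F)
    (hA : ∀ a b, ‖A a b‖ ≤ 1) : ((integralMatrix A hA).det : F) = A.det := by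
  have h := RingHom.map_det (algebraMap (integers F) F) (integralMatrix A hA)
  exact h

theorem norm_det_le_one {m : Type*} [Fintype m] [DecidableEq m] {A : Matrix m m F}
    (hA : ∀ a b, ‖A a b‖ ≤ 1) : ‖A.det‖ ≤ 1 := by
  rw [← coe_det_integralMatrix A hA]
  exact mem_integers_iff.1 (integralMatrix A hA).det.2

variable {n : ℕ}

theorem norm_apply_le_one_of_mem_maxCompact {k : GL (Fin n) F} (hk : k ∈ maxCompact F n)
    (a b : Fin n) : ‖k.val a b‖ ≤ 1 := by
  obtain ⟨k, rfl⟩ := hk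
  exact mem_integers_iff.1 (k.val a b).2

theorem mem_maxCompact_iff {k : GL (Fin n) F} :
    k ∈ maxCompact F n ↔ (∀ a b, ‖k.val a b‖ ≤ 1) ∧ ‖k.val.det‖ = 1 := by
  constructor
  · intro hk
    have h1 := norm_det_le_one (norm_apply_le_one_of_mem_maxCompact hk)
    have h2 := norm_det_le_one (norm_apply_le_one_of_mem_maxCompact (inv_mem hk))
    refine ⟨norm_apply_le_one_of_mem_maxCompact hk, ?_⟩
    have h3 : ‖k.val.det‖ * ‖(k⁻¹).val.det‖ = 1 := by
      rw [← norm_mul, ← Matrix.det_mul, Units.mul_inv, Matrix.det_one, norm_one]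
    nlinarith [norm_nonneg k.val.det]
  · rintro ⟨h1, h2⟩
    have hu : IsUnit (integralMatrix k.val h1).det := by
      rw [isUnit_integers_iff, coe_det_integralMatrix, h2]
    refine ⟨Matrix.GeneralLinearGroup.mk'' (integralMatrix k.val h1) hu, ?_⟩
    ext a b
    rfl

theorem mem_maxCompact_of_integral {k : GL (Fin n) F} (h : ∀ a b, ‖k.val a b‖ ≤ 1)
    (h' : ∀ a b, ‖(k⁻¹).val a b‖ ≤ 1) : k ∈ maxCompact F n := by
  have h1 := norm_det_le_one h
  have h2 := norm_det_le_one h'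
  refine mem_maxCompact_iff.2 ⟨h, ?_⟩
  have h3 : ‖k.val.det‖ * ‖(k⁻¹).val.det‖ = 1 := by
    rw [← norm_mul, ← Matrix.det_mul, Units.mul_inv, Matrix.det_one, norm_one]
  nlinarith [norm_nonneg k.val.det]

end IntegralMatrices

/-! ### Discreteness of the norm -/

namespace IsNormalizedUniformizer

variable {F : Type*} [NontriviallyNormedField F] [IsUltrametricDist F] {ϖ : F}

theorem norm_pos (hϖ : IsNormalizedUniformizer ϖ) : 0 < ‖ϖ‖ := by
  obtain ⟨x, hx0, hx⟩ := NormedField.exists_norm_lt_one F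
  exact hx0.trans_le (hϖ.norm_le x hx)

theorem ne_zero (hϖ : IsNormalizedUniformizer ϖ) : ϖ ≠ 0 := norm_pos_iff.1 hϖ.norm_pos

theorem one_lt_resCard (hϖ : IsNormalizedUniformizer ϖ) : 1 < resCard F := by
  -- `Nat.card` of an infinite residue field would be `0`, and then `‖ϖ‖ = 0⁻¹ = 0`.
  have h0 : resCard F ≠ 0 := by
    intro h
    have := hϖ.norm_pos
    rw [hϖ.norm_eq, h] at this
    simp at this
  have h1 := resCard_ne_one (F := F)
  omega

theorem norm_lt_one (hϖ : IsNormalizedUniformizer ϖ) : ‖ϖ‖ < 1 := by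
  rw [hϖ.norm_eq]
  exact inv_lt_one_of_one_lt₀ (by exact_mod_cast hϖ.one_lt_resCard)

/-- A power of `ϖ` scales `x` to norm in `(‖ϖ‖, 1]`. No norm lies strictly between `‖ϖ‖` and `1`, so
the scaled element has norm `1`. -/
theorem exists_norm_eq_zpow (hϖ : IsNormalizedUniformizer ϖ) {x : F} (hx : x ≠ 0) :
    ∃ k : ℤ, ‖x‖ = ‖ϖ‖ ^ k := by
  have hpos := hϖ.norm_pos
  obtain ⟨k, hk1, hk2⟩ := exists_mem_Ioc_zpow (norm_pos_iff.2 hx)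
    ((one_lt_inv₀ hpos).2 hϖ.norm_lt_one)
  have hy : ‖x * ϖ ^ (k + 1)‖ = ‖x‖ * ‖ϖ‖ ^ (k + 1) := by rw [norm_mul, norm_zpow]
  have hp : 0 < ‖ϖ‖ ^ (k + 1) := zpow_pos hpos _
  rw [inv_zpow] at hk1 hk2
  have h1 : ‖x * ϖ ^ (k + 1)‖ ≤ 1 := by
    rw [hy]
    calc ‖x‖ * ‖ϖ‖ ^ (k + 1) ≤ (‖ϖ‖ ^ (k + 1))⁻¹ * ‖ϖ‖ ^ (k + 1) := by gcongr
      _ = 1 := inv_mul_cancel₀ hp.ne'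
  have h2 : ‖ϖ‖ < ‖x * ϖ ^ (k + 1)‖ := by
    rw [hy]
    calc ‖ϖ‖ = (‖ϖ‖ ^ k)⁻¹ * ‖ϖ‖ ^ (k + 1) := by
          rw [zpow_add_one₀ hpos.ne', inv_mul_cancel_left₀ (zpow_pos hpos k).ne']
      _ < ‖x‖ * ‖ϖ‖ ^ (k + 1) := by gcongr
  have h3 : ‖x * ϖ ^ (k + 1)‖ = 1 := by
    by_contra hne
    exact absurd (hϖ.norm_le _ (lt_of_le_of_ne h1 hne)) (not_le.2 h2)
  refine ⟨-(k + 1), ?_⟩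
  rw [zpow_neg, ← mul_right_cancel_iff_of_pos hp, inv_mul_cancel₀ hp.ne', ← hy, h3]

end IsNormalizedUniformizer

/-! ### Bordered matrices and one step of elimination -/

section ConsMatrix

variable {F : Type*} [Field F] {m : ℕ}

/-- The matrix with blocks `a`, `r`, `c` and `A`. -/
def consMatrix (a : F) (r c : Fin m → F) (A : Matrix (Fin m) (Fin m) F) :
    Matrix (Fin (m + 1)) (Fin (m + 1)) F :=
  Matrix.of (Fin.cons (Fin.cons a r) fun i => Fin.cons (c i) (A i))

@[simp] theorem consMatrix_zero_zero (a : F) (r c : Fin m → F) (A : Matrix (Fin m) (Fin m) F) :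
    consMatrix a r c A 0 0 = a := rfl
@[simp] theorem consMatrix_zero_succ (a : F) (r c : Fin m → F) (A : Matrix (Fin m) (Fin m) F)
    (j : Fin m) : consMatrix a r c A 0 j.succ = r j := rfl
@[simp] theorem consMatrix_succ_zero (a : F) (r c : Fin m → F) (A : Matrix (Fin m) (Fin m) F)
    (i : Fin m) : consMatrix a r c A i.succ 0 = c i := rfl
@[simp] theorem consMatrix_succ_succ (a : F) (r c : Fin m → F) (A : Matrix (Fin m) (Fin m) F)
    (i j : Fin m) : consMatrix a r c A i.succ j.succ = A i j := rfl

theorem det_consMatrix_of_row (a : F) (c : Fin m → F) (A : Matrix (Fin m) (Fin m) F) :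
    (consMatrix a 0 c A).det = a * A.det := by
  rw [Matrix.det_succ_row_zero, Fin.sum_univ_succ]
  simp only [consMatrix_zero_succ, consMatrix_zero_zero, Pi.zero_apply]
  simp only [Fin.coe_ofNat_eq_mod, Nat.zero_mod, pow_zero, mul_zero, zero_mul,
    Finset.sum_const_zero, add_zero, one_mul]
  rfl

theorem det_consMatrix_of_col (a : F) (r : Fin m → F) (A : Matrix (Fin m) (Fin m) F) :
    (consMatrix a r 0 A).det = a * A.det := by
  rw [Matrix.det_succ_column_zero, Fin.sum_univ_succ]
  simp only [consMatrix_succ_zero, consMatrix_zero_zero, Pi.zero_apply]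
  simp only [Fin.coe_ofNat_eq_mod, Nat.zero_mod, pow_zero, mul_zero, zero_mul,
    Finset.sum_const_zero, add_zero, one_mul]
  rfl

theorem consMatrix_mul_diag (a b : F) (A B : Matrix (Fin m) (Fin m) F) :
    consMatrix a 0 0 A * consMatrix b 0 0 B = consMatrix (a * b) 0 0 (A * B) := by
  ext i j
  rw [Matrix.mul_apply, Fin.sum_univ_succ]
  refine Fin.cases ?_ (fun i => ?_) i <;> refine Fin.cases ?_ (fun j => ?_) j <;>
    simp [Matrix.mul_apply]

/-- The block diagonal matrix `(a, g)`. -/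
def consGL (a : Fˣ) (g : GL (Fin m) F) : GL (Fin (m + 1)) F where
  val := consMatrix a 0 0 g.val
  inv := consMatrix (a⁻¹ : Fˣ) 0 0 (g⁻¹).val
  val_inv := by
    rw [consMatrix_mul_diag, Units.mul_inv, Units.mul_inv]
    ext i j
    refine Fin.cases ?_ (fun i => ?_) i <;> refine Fin.cases ?_ (fun j => ?_) j <;>
      simp [Matrix.one_apply, eq_comm]
  inv_val := by
    rw [consMatrix_mul_diag, Units.inv_mul, Units.inv_mul]
    ext i j
    refine Fin.cases ?_ (fun i => ?_) i <;> refine Fin.cases ?_ (fun j => ?_) j <;>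
      simp [Matrix.one_apply, eq_comm]

theorem consGL_mul (a b : Fˣ) (g h : GL (Fin m) F) :
    consGL a g * consGL b h = consGL (a * b) (g * h) :=
  Units.ext (consMatrix_mul_diag _ _ _ _)

/-- Clearing the first row and column with the pivot `a`; the middle factor contains the Schur
complement. -/
theorem consMatrix_factor {a : F} (ha : a ≠ 0) (r c : Fin m → F) (A : Matrix (Fin m) (Fin m) F) :
    consMatrix a r c A = consMatrix 1 0 (fun i => c i / a) 1 *
      consMatrix a 0 0 (A - Matrix.of fun i j => c i * r j / a) *
        consMatrix 1 (fun j => r j / a) 0 1 := by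
  ext i j
  simp only [Matrix.mul_apply, Fin.sum_univ_succ]
  refine Fin.cases ?_ (fun i => ?_) i <;> refine Fin.cases ?_ (fun j => ?_) j <;>
    simp [Matrix.one_apply] <;> field_simp
  ring

theorem eq_consMatrix (A : Matrix (Fin (m + 1)) (Fin (m + 1)) F) :
    A = consMatrix (A 0 0) (fun j => A 0 j.succ) (fun i => A i.succ 0)
      (A.submatrix Fin.succ Fin.succ) := by
  ext i j
  refine Fin.cases ?_ (fun i => ?_) i <;> refine Fin.cases ?_ (fun j => ?_) j <;> rfl

end ConsMatrix

section Diagonal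

variable {F : Type*} [NontriviallyNormedField F] {m : ℕ}

theorem consGL_diagGL (a : Fˣ) (t : Fin m → Fˣ) :
    consGL a (diagGL t) = diagGL (Fin.cons a t) := by
  ext i j
  change consMatrix _ _ _ _ i j = _
  refine Fin.cases ?_ (fun i => ?_) i <;> refine Fin.cases ?_ (fun j => ?_) j <;>
    simp [Matrix.diagonal_apply, eq_comm]

theorem norm_cons (a : Fˣ) (t : Fin m → Fˣ) :
    (fun i => ‖((Fin.cons a t : Fin (m + 1) → Fˣ) i : F)‖) =
      Fin.cons ‖(a : F)‖ fun i => ‖(t i : F)‖ := by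
  funext i
  refine Fin.cases ?_ (fun i => ?_) i <;> simp

end Diagonal

/-! ### Cartan decomposition and elementary divisors -/

section Cartan

variable {F : Type*} [NontriviallyNormedField F] [IsUltrametricDist F] {m : ℕ}

theorem consGL_mem_maxCompact {a : Fˣ} (ha : ‖(a : F)‖ = 1) {g : GL (Fin m) F}
    (hg : g ∈ maxCompact F m) : consGL a g ∈ maxCompact F (m + 1) := by
  rw [mem_maxCompact_iff] at hg ⊢
  refine ⟨fun i j => ?_, ?_⟩
  · change ‖consMatrix _ _ _ _ i j‖ ≤ 1
    refine Fin.cases ?_ (fun i => ?_) i <;> refine Fin.cases ?_ (fun j => ?_) j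
    · simp [ha]
    · simp
    · simp
    · simpa using hg.1 i j
  · change ‖(consMatrix _ _ _ _).det‖ = 1
    rw [det_consMatrix_of_row, norm_mul, ha, hg.2, one_mul]

theorem exists_mem_maxCompact_row {r : Fin m → F} (hr : ∀ j, ‖r j‖ ≤ 1) :
    ∃ k ∈ maxCompact F (m + 1), k.val = consMatrix 1 r 0 1 := by
  have hd : (consMatrix (1 : F) r 0 (1 : Matrix (Fin m) (Fin m) F)).det = 1 := by
    rw [det_consMatrix_of_col, Matrix.det_one, one_mul]
  refine ⟨Matrix.GeneralLinearGroup.mkOfDetNeZero _ (hd.trans_ne one_ne_zero),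
    mem_maxCompact_iff.2 ⟨fun i j => ?_, ?_⟩, rfl⟩
  · change ‖consMatrix _ _ _ _ i j‖ ≤ 1
    refine Fin.cases ?_ (fun i => ?_) i <;> refine Fin.cases ?_ (fun j => ?_) j
    · simp
    · simpa using hr j
    · simp
    · simp only [consMatrix_succ_succ, Matrix.one_apply]
      split_ifs <;> simp
  · exact (congrArg norm hd).trans norm_one

theorem exists_mem_maxCompact_col {c : Fin m → F} (hc : ∀ j, ‖c j‖ ≤ 1) :
    ∃ k ∈ maxCompact F (m + 1), k.val = consMatrix 1 0 c 1 := by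
  have hd : (consMatrix (1 : F) 0 c (1 : Matrix (Fin m) (Fin m) F)).det = 1 := by
    rw [det_consMatrix_of_row, Matrix.det_one, one_mul]
  refine ⟨Matrix.GeneralLinearGroup.mkOfDetNeZero _ (hd.trans_ne one_ne_zero),
    mem_maxCompact_iff.2 ⟨fun i j => ?_, ?_⟩, rfl⟩
  · change ‖consMatrix _ _ _ _ i j‖ ≤ 1
    refine Fin.cases ?_ (fun i => ?_) i <;> refine Fin.cases ?_ (fun j => ?_) j
    · simp
    · simp
    · simpa using hc i
    · simp only [consMatrix_succ_succ, Matrix.one_apply]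
      split_ifs <;> simp
  · exact (congrArg norm hd).trans norm_one

/-- The double coset relation for the maximal compact subgroup. -/
def MaxCompactRel (g g' : GL (Fin m) F) : Prop :=
  ∃ k₁ ∈ maxCompact F m, ∃ k₂ ∈ maxCompact F m, k₁ * g * k₂ = g'

theorem MaxCompactRel.symm {g g' : GL (Fin m) F} (h : MaxCompactRel g g') :
    MaxCompactRel g' g := by
  obtain ⟨k₁, h₁, k₂, h₂, rfl⟩ := h
  exact ⟨k₁⁻¹, inv_mem h₁, k₂⁻¹, inv_mem h₂, by group⟩

theorem MaxCompactRel.trans {g g' g'' : GL (Fin m) F} (h : MaxCompactRel g g')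
    (h' : MaxCompactRel g' g'') : MaxCompactRel g g'' := by
  obtain ⟨k₁, h₁, k₂, h₂, rfl⟩ := h
  obtain ⟨l₁, h₃, l₂, h₄, rfl⟩ := h'
  exact ⟨l₁ * k₁, mul_mem h₃ h₁, k₂ * l₂, mul_mem h₂ h₄, by group⟩

theorem MaxCompactRel.consGL (a : Fˣ) {g g' : GL (Fin m) F} (h : MaxCompactRel g g') :
    MaxCompactRel (consGL a g) (GLTrunc.consGL a g') := by
  obtain ⟨k₁, h₁, k₂, h₂, rfl⟩ := h
  refine ⟨GLTrunc.consGL 1 k₁, consGL_mem_maxCompact (by simp) h₁, GLTrunc.consGL 1 k₂,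
    consGL_mem_maxCompact (by simp) h₂, ?_⟩
  rw [consGL_mul, consGL_mul, one_mul, mul_one]

theorem norm_mul_apply_le {l n p : Type*} [Fintype n] {A : Matrix l n F} {B : Matrix n p F}
    {C D : ℝ} (hC : 0 ≤ C) (hD : 0 ≤ D) (hA : ∀ a b, ‖A a b‖ ≤ C) (hB : ∀ a b, ‖B a b‖ ≤ D)
    (a : l) (b : p) : ‖(A * B) a b‖ ≤ C * D := by
  rw [Matrix.mul_apply]
  refine IsUltrametricDist.norm_sum_le_of_forall_le_of_nonneg (by positivity) fun i _ => ?_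
  rw [norm_mul]
  exact mul_le_mul (hA _ _) (hB _ _) (norm_nonneg _) hC

/-- By the ultrametric inequality, multiplication by integral matrices does not increase the largest
entry norm, which is therefore an invariant of the double coset. -/
theorem MaxCompactRel.norm_le {g g' : GL (Fin m) F} (h : MaxCompactRel g g') {C : ℝ}
    (hC : 0 ≤ C) (hg : ∀ i j, ‖g.val i j‖ ≤ C) (i j : Fin m) : ‖g'.val i j‖ ≤ C := by
  obtain ⟨k₁, h₁, k₂, h₂, rfl⟩ := h
  have := norm_mul_apply_le (mul_nonneg zero_le_one hC) zero_le_one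
    (norm_mul_apply_le zero_le_one hC (norm_apply_le_one_of_mem_maxCompact h₁) hg)
    (norm_apply_le_one_of_mem_maxCompact h₂) i j
  simpa using this

theorem exists_permMatrix_mem_maxCompact (σ : Equiv.Perm (Fin m)) :
    ∃ k ∈ maxCompact F m, k.val = σ.permMatrix F := by
  have hd : ‖(σ.permMatrix F).det‖ = 1 := by
    rw [Matrix.det_permutation]
    rcases Int.units_eq_one_or (Equiv.Perm.sign σ) with h | h <;> simp [h]
  refine ⟨Matrix.GeneralLinearGroup.mkOfDetNeZero _ (norm_ne_zero_iff.1 (hd.trans_ne one_ne_zero)),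
    mem_maxCompact_iff.2 ⟨fun i j => ?_, hd⟩, rfl⟩
  change ‖σ.permMatrix F i j‖ ≤ 1
  rw [Equiv.Perm.permMatrix, PEquiv.toMatrix_apply]
  split_ifs <;> simp

/-- When the corner entry has the largest norm, the multipliers of the elimination step are
integral, so both unipotent factors lie in the maximal compact subgroup. The explicit Schur
complement is recorded for the triangular case. -/
theorem exists_maxCompactRel_consGL {g : GL (Fin (m + 1)) F}
    (hmax : ∀ i j, ‖g.val i j‖ ≤ ‖g.val 0 0‖) :
    ∃ (a : Fˣ) (g' : GL (Fin m) F), (a : F) = g.val 0 0 ∧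
      (∀ i j, g'.val i j = g.val i.succ j.succ - g.val i.succ 0 * g.val 0 j.succ / g.val 0 0) ∧
      MaxCompactRel (consGL a g') g := by
  have ha : g.val 0 0 ≠ 0 := by
    intro h0
    have hz : g.val = 0 := by
      ext i j
      simpa [h0] using hmax i j
    have h1 := g.isUnit
    rw [hz] at h1
    exact not_isUnit_zero h1
  have hapos := norm_pos_iff.2 ha
  obtain ⟨k₁, hk₁, hv₁⟩ := exists_mem_maxCompact_col (F := F)
    (c := fun i : Fin m => g.val i.succ 0 / g.val 0 0)
    fun i => by rw [norm_div]; exact div_le_one_of_le₀ (hmax _ _) hapos.le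
  obtain ⟨k₂, hk₂, hv₂⟩ := exists_mem_maxCompact_row (F := F)
    (r := fun j : Fin m => g.val 0 j.succ / g.val 0 0)
    fun i => by rw [norm_div]; exact div_le_one_of_le₀ (hmax _ _) hapos.le
  set A : Matrix (Fin m) (Fin m) F := g.val.submatrix Fin.succ Fin.succ -
    Matrix.of fun i j => g.val i.succ 0 * g.val 0 j.succ / g.val 0 0 with hA
  have hfac : g.val = k₁.val * consMatrix (g.val 0 0) 0 0 A * k₂.val := by
    conv_lhs => rw [eq_consMatrix g.val, consMatrix_factor ha]
    rw [hv₁, hv₂]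
  have hdet : A.det ≠ 0 := by
    intro h0
    have h1 := congrArg Matrix.det hfac
    rw [Matrix.det_mul, Matrix.det_mul, det_consMatrix_of_row, h0] at h1
    have h2 := (Matrix.isUnit_iff_isUnit_det _).1 g.isUnit
    rw [h1] at h2
    simp at h2
  refine ⟨Units.mk0 _ ha, Matrix.GeneralLinearGroup.mkOfDetNeZero A hdet, rfl, fun i j => rfl,
    k₁, hk₁, k₂, hk₂, Units.ext hfac.symm⟩

theorem antitone_cons {a : ℝ} {v : Fin m → ℝ} (ha : ∀ i, v i ≤ a) (hv : Antitone v) :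
    Antitone (Fin.cons a v : Fin (m + 1) → ℝ) := by
  intro i j
  refine Fin.cases ?_ (fun i => ?_) i <;> refine Fin.cases ?_ (fun j => ?_) j
  · simp
  · intro _; simpa using ha j
  · intro h; simp at h
  · intro h; simpa using hv (Fin.succ_le_succ_iff.1 h)

theorem norm_le_of_maxCompactRel_diagGL {g : GL (Fin m) F} {t : Fin m → Fˣ}
    (h : MaxCompactRel g (diagGL t)) {C : ℝ} (hC : 0 ≤ C) (hg : ∀ i j, ‖g.val i j‖ ≤ C)
    (i : Fin m) : ‖(t i : F)‖ ≤ C := by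
  simpa using h.norm_le hC hg i i

/-- The Cartan decomposition. -/
theorem exists_maxCompactRel_diagGL (g : GL (Fin m) F) :
    ∃ t : Fin m → Fˣ, MaxCompactRel g (diagGL t) ∧ Antitone fun i => ‖(t i : F)‖ := by
  induction m with
  | zero => exact ⟨fun _ => 1, ⟨1, one_mem _, 1, one_mem _, by ext i; exact i.elim0⟩,
      fun i => i.elim0⟩
  | succ m ih =>
    obtain ⟨⟨i₀, j₀⟩, -, hmax⟩ := Finset.exists_max_image (Finset.univ)
      (fun p : Fin (m + 1) × Fin (m + 1) => ‖g.val p.1 p.2‖) ⟨(0, 0), Finset.mem_univ _⟩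
    -- Row and column swaps bring an entry of largest norm to the corner.
    obtain ⟨k₁, hk₁, hv₁⟩ := exists_permMatrix_mem_maxCompact (F := F) (Equiv.swap 0 i₀)
    obtain ⟨k₂, hk₂, hv₂⟩ := exists_permMatrix_mem_maxCompact (F := F) (Equiv.swap 0 j₀)
    have hrel : MaxCompactRel g (k₁ * g * k₂) := ⟨k₁, hk₁, k₂, hk₂, rfl⟩
    have hval : ∀ i j, (k₁ * g * k₂).val i j =
        g.val (Equiv.swap 0 i₀ i) (Equiv.swap 0 j₀ j) := by
      intro i j
      rw [Units.val_mul, Units.val_mul, hv₁, hv₂, PEquiv.mul_toMatrix_toPEquiv,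
        PEquiv.toMatrix_toPEquiv_mul]
      simp
    obtain ⟨a, g', ha, -, hrel'⟩ := exists_maxCompactRel_consGL (g := k₁ * g * k₂) (by
      intro i j
      rw [hval, hval, Equiv.swap_apply_left, Equiv.swap_apply_left]
      exact hmax (_, _) (Finset.mem_univ _))
    obtain ⟨t, ht, hanti⟩ := ih g'
    have hbound : ∀ i j, ‖(consGL a g').val i j‖ ≤ ‖(a : F)‖ := by
      refine hrel'.symm.norm_le (norm_nonneg _) fun i j => ?_
      rw [ha, hval, hval, Equiv.swap_apply_left, Equiv.swap_apply_left]
      exact hmax (_, _) (Finset.mem_univ _)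
    refine ⟨Fin.cons a t, ?_, ?_⟩
    · rw [← consGL_diagGL]
      exact hrel.trans (hrel'.symm.trans (ht.consGL a))
    · rw [norm_cons]
      exact antitone_cons (norm_le_of_maxCompactRel_diagGL ht (norm_nonneg _)
        fun i j => hbound i.succ j.succ) hanti

theorem toLex_le_cons {v w : Fin (m + 1) → ℝ} (h0 : v 0 = w 0)
    (h : toLex (fun i : Fin m => v i.succ) ≤ toLex (fun i : Fin m => w i.succ)) :
    toLex v ≤ toLex w := by
  rcases h.eq_or_lt with h | ⟨i, hi, hlt⟩
  · refine le_of_eq (congrArg toLex (funext fun i => ?_))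
    exact Fin.cases h0 (fun i => congrFun (toLex.injective h) i) i
  · refine le_of_lt ⟨i.succ, fun j => ?_, hlt⟩
    exact Fin.cases (fun _ => h0) (fun j hj => hi j (Fin.succ_lt_succ_iff.1 hj)) j

/-- For upper triangular matrices, the elementary divisors dominate the diagonal entries in the
lexicographic order, and equality forces the matrix to be a diagonal matrix times an integral
one. -/
theorem exists_maxCompactRel_diagGL_of_upper (g : GL (Fin m) F)
    (hg : ∀ i j, j < i → g.val i j = 0) :
    ∃ t : Fin m → Fˣ, MaxCompactRel g (diagGL t) ∧ (Antitone fun i => ‖(t i : F)‖) ∧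
      toLex (fun i => ‖g.val i i‖) ≤ toLex (fun i => ‖(t i : F)‖) ∧
      ((∀ i, ‖g.val i i‖ = ‖(t i : F)‖) → ∀ i j, ‖g.val i j‖ ≤ ‖g.val i i‖) := by
  induction m with
  | zero =>
    obtain ⟨t, h1, h2⟩ := exists_maxCompactRel_diagGL g
    exact ⟨t, h1, h2, le_of_eq (congrArg toLex (funext fun i => i.elim0)),
      fun _ i => i.elim0⟩
  | succ m ih =>
    by_cases hmax : ∀ i j, ‖g.val i j‖ ≤ ‖g.val 0 0‖
    · obtain ⟨a, g', ha, hg', hrel⟩ := exists_maxCompactRel_consGL hmax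
      -- The first column vanishes below the pivot, so elimination leaves the lower block unchanged
      -- and upper triangular.
      have hg'' : ∀ i j, g'.val i j = g.val i.succ j.succ := by
        intro i j
        rw [hg', hg i.succ 0 (Fin.succ_pos i)]
        simp
      obtain ⟨t, ht, hanti, hlex, heq⟩ := ih g' fun i j hij => by
        rw [hg'', hg _ _ (Fin.succ_lt_succ_iff.2 hij)]
      refine ⟨Fin.cons a t, ?_, ?_, toLex_le_cons ?_ ?_, fun h i j => ?_⟩
      · rw [← consGL_diagGL]
        exact hrel.symm.trans (ht.consGL a)
      · rw [norm_cons]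
        refine antitone_cons (norm_le_of_maxCompactRel_diagGL ht (norm_nonneg _) fun i j => ?_)
          hanti
        rw [hg'', ha]
        exact hmax _ _
      · simp [ha]
      · simpa [hg''] using hlex
      · refine Fin.cases (hmax 0 j) (fun i => ?_) i
        refine Fin.cases ?_ (fun j => ?_) j
        · rw [hg i.succ 0 (Fin.succ_pos i)]; simp
        · rw [← hg'', ← hg'']
          exact heq (fun i => by simpa [hg''] using h i.succ) i j
    · obtain ⟨t, ht, hanti⟩ := exists_maxCompactRel_diagGL g
      -- Otherwise `‖g.val 0 0‖` would bound all the elementary divisors, hence all entries of `g`.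
      -- The lexicographic inequality is thus strict at the first index.
      have hlt : ‖g.val 0 0‖ < ‖(t 0 : F)‖ := by
        by_contra! hle
        refine hmax (ht.symm.norm_le (norm_nonneg _) fun i j => ?_)
        rw [diagGL_val, Matrix.diagonal_apply]
        split_ifs
        · exact (hanti (Fin.zero_le i)).trans hle
        · simp
      refine ⟨t, ht, hanti, le_of_lt ⟨0, fun j hj => absurd hj (Fin.not_lt_zero j), hlt⟩,
        fun h => absurd (h 0) hlt.ne⟩

end Cartan

/-! ### Entries of unipotent matrices and normalisation of Haar measure -/

section Unipotent

variable {F : Type*} [NontriviallyNormedField F] {n : ℕ}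

theorem ones_index_val (a : Fin n) : ((Composition.ones n).index a : ℕ) = a := by
  have h1 := (Composition.ones n).sizeUpTo_index_le a
  have h2 := (Composition.ones n).lt_sizeUpTo_index_succ a
  have h3 := ((Composition.ones n).index a).2
  rw [Composition.ones_sizeUpTo] at h1 h2
  simp only [Composition.ones_length, Fin.val_succ] at h1 h2 h3
  omega

theorem ones_index_lt_iff {a b : Fin n} :
    (Composition.ones n).index a < (Composition.ones n).index b ↔ a < b := by
  rw [Fin.lt_def, Fin.lt_def, ones_index_val, ones_index_val]

theorem unip_apply_self (c : Composition n) (x : UpperPos c → F) (a : Fin n) :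
    (unip c x).val a a = 1 := by
  simp [unip, unipMatrix]

theorem unip_apply_of_lt (c : Composition n) (x : UpperPos c → F) {a b : Fin n}
    (h : c.index a < c.index b) : (unip c x).val a b = x ⟨(a, b), h⟩ := by
  have hab : a ≠ b := fun e => by simp [e] at h
  simp [unip, unipMatrix, h, Matrix.one_apply_ne hab]

theorem unip_apply_of_not_lt (c : Composition n) (x : UpperPos c → F) {a b : Fin n}
    (h : ¬ c.index a < c.index b) :
    (unip c x).val a b = (1 : Matrix (Fin n) (Fin n) F) a b := by
  simp [unip, unipMatrix, h]

theorem unip_ones_apply_of_gt (x : UpperPos (Composition.ones n) → F) {a b : Fin n}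
    (h : b < a) : (unip (Composition.ones n) x).val a b = 0 := by
  rw [unip_apply_of_not_lt _ _ (by rw [ones_index_lt_iff]; exact h.asymm),
    Matrix.one_apply_ne h.ne']

theorem unip_mem_maxCompact [IsUltrametricDist F] {c : Composition n} {x : UpperPos c → F}
    (hx : ∀ p, ‖x p‖ ≤ 1) : unip c x ∈ maxCompact F n := by
  refine mem_maxCompact_iff.2 ⟨fun a b => ?_, ?_⟩
  · by_cases h : c.index a < c.index b
    · rw [unip_apply_of_lt c x h]; exact hx _
    · rw [unip_apply_of_not_lt c x h, Matrix.one_apply]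
      split_ifs <;> simp
  · exact (congrArg norm (det_unipMatrix c x)).trans norm_one

end Unipotent

section Haar

variable {F : Type*} [NontriviallyNormedField F] [ProperSpace F] [MeasurableSpace F]
  [BorelSpace F]

instance : (haarF F).IsAddHaarMeasure := by unfold haarF; infer_instance

theorem haarF_closedBall : haarF F (Metric.closedBall 0 1) = 1 :=
  Measure.addHaarMeasure_self (K₀ := unitBall F)

end Haar

/-! ### Injectivity of the Satake transform on products of general linear groups -/

section SatakeInjectivity

theorem finite_zpow_mem_Icc {ρ C : ℝ} (hρ : 0 < ρ) (hρ1 : ρ < 1) :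
    {x : ℝ | (∃ k : ℤ, x = ρ ^ k) ∧ x ≤ C ∧ x⁻¹ ≤ C}.Finite := by
  rcases le_or_gt C 0 with hC | hC
  · convert Set.finite_empty
    rw [Set.eq_empty_iff_forall_notMem]
    rintro _ ⟨⟨k, rfl⟩, h, -⟩
    exact absurd (zpow_pos hρ k) (by linarith)
  obtain ⟨N, hN⟩ := exists_pow_lt_of_lt_one (inv_pos.2 hC) hρ1
  refine ((Set.finite_Icc (-(N : ℤ)) N).image fun k => ρ ^ k).subset ?_
  rintro _ ⟨⟨k, rfl⟩, h1, h2⟩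
  refine ⟨k, ⟨?_, ?_⟩, rfl⟩
  · by_contra! hk
    have h3 : ρ ^ (-(N : ℤ)) ≤ ρ ^ k := zpow_le_zpow_right_of_le_one₀ hρ hρ1.le hk.le
    rw [zpow_neg, zpow_natCast] at h3
    have h4 : C < (ρ ^ N)⁻¹ := by rwa [lt_inv_comm₀ hC (pow_pos hρ N)]
    linarith
  · by_contra! hk
    have h3 : ρ ^ k ≤ ρ ^ (N : ℤ) := zpow_le_zpow_right_of_le_one₀ hρ hρ1.le hk.le
    rw [zpow_natCast] at h3
    have h4 : (ρ ^ k)⁻¹ ≤ C := h2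
    rw [inv_le_comm₀ (zpow_pos hρ k) hC] at h4
    linarith

variable {F : Type*} [NontriviallyNormedField F] [IsUltrametricDist F] [ProperSpace F]
  [MeasurableSpace F] [BorelSpace F] {l : ℕ} {m : Fin l → ℕ}

/-- The measure on the upper triangular unipotent matrices of a product of general linear
groups. -/
noncomputable abbrev unipMeasure (F : Type*) [NontriviallyNormedField F] [ProperSpace F]
    [MeasurableSpace F] [BorelSpace F] (m : Fin l → ℕ) :
    Measure (∀ i, UpperPos (Composition.ones (m i)) → F) :=
  Measure.pi fun _ => Measure.pi fun _ => haarF F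

/-- The support of `h` has bounded matrix entries, as have the inverses of its elements. -/
def HasBoundedSupport (h : (∀ i, GL (Fin (m i)) F) → ℂ) : Prop :=
  ∃ C : ℝ, ∀ g, h g ≠ 0 → ∀ i a b, ‖(g i).val a b‖ ≤ C ∧ ‖(g i)⁻¹.val a b‖ ≤ C

/-- The Satake transform of a product of general linear groups is injective on bi-invariant
functions. -/
theorem eq_zero_of_integral_eq_zero {ϖ : F} (hϖ : IsNormalizedUniformizer ϖ)
    {h : (∀ i, GL (Fin (m i)) F) → ℂ}
    (hK : ∀ k₁ k₂ g, (∀ i, k₁ i ∈ maxCompact F (m i)) → (∀ i, k₂ i ∈ maxCompact F (m i)) →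
      h (k₁ * g * k₂) = h g)
    (hbd : HasBoundedSupport h)
    (hint : ∀ t : ∀ i, Fin (m i) → Fˣ,
      ∫ y, h (fun i => diagGL (t i) * unip (Composition.ones (m i)) (y i)) ∂(unipMeasure F m) = 0)
    (g : ∀ i, GL (Fin (m i)) F) : h g = 0 := by
  by_contra hg
  have hrel : ∀ g g' : ∀ i, GL (Fin (m i)) F, (∀ i, MaxCompactRel (g i) (g' i)) →
      h g' = h g := by
    intro g g' hgg
    choose k₁ h₁ k₂ h₂ h₃ using hgg
    rw [← hK k₁ k₂ g h₁ h₂]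
    exact congrArg h (funext fun i => (h₃ i).symm)
  obtain ⟨C, hC⟩ := hbd
  -- Norm vectors of the diagonal elements in the support. Bounded support and discreteness of the
  -- norm make `S` finite; the Cartan decomposition makes it nonempty.
  let S : Set (∀ i, Fin (m i) → ℝ) := {v | ∃ t : ∀ i, Fin (m i) → Fˣ,
    (v = fun i a => ‖(t i a : F)‖) ∧ h (fun i => diagGL (t i)) ≠ 0}
  have hfin : S.Finite := by
    refine (Set.Finite.pi' fun i => Set.Finite.pi' fun a =>
      finite_zpow_mem_Icc (C := C) hϖ.norm_pos hϖ.norm_lt_one).subset ?_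
    rintro _ ⟨t, rfl, ht⟩ i a
    refine ⟨hϖ.exists_norm_eq_zpow (t i a).ne_zero, ?_, ?_⟩
    · simpa using (hC _ ht i a a).1
    · simpa [diagGL_inv] using (hC _ ht i a a).2
  have hne : S.Nonempty := by
    choose t ht hanti using fun i => exists_maxCompactRel_diagGL (g i)
    exact ⟨_, t, rfl, by rwa [hrel g _ ht]⟩
  obtain ⟨_, ⟨t, rfl, ht⟩, hmax⟩ := hfin.exists_maximalFor
    (fun v => toLex fun i => toLex (v i)) S hne
  -- For maximal `t` only integral unipotents contribute: if `h` is nonzero at `t u`, the elementary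
  -- divisors of `t u` lie in `S` and dominate `t`, so they equal `t`, and this forces `u` to be
  -- integral.
  have hval : ∀ y : ∀ i, UpperPos (Composition.ones (m i)) → F,
      h (fun i => diagGL (t i) * unip (Composition.ones (m i)) (y i)) =
        Set.indicator (Set.univ.pi fun i => Set.univ.pi fun _ => Metric.closedBall (0 : F) 1)
          (fun _ => h fun i => diagGL (t i)) y := by
    intro y
    by_cases hy : y ∈ Set.univ.pi fun i => Set.univ.pi fun _ => Metric.closedBall (0 : F) 1
    · rw [Set.indicator_of_mem hy]
      refine hrel _ _ fun i => ⟨1, one_mem _, _, unip_mem_maxCompact (x := y i) fun p => ?_,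
        by rw [one_mul]⟩
      simpa using hy i trivial p trivial
    · rw [Set.indicator_of_notMem hy]
      by_contra hne
      have hent : ∀ i a b, (diagGL (t i) * unip (Composition.ones (m i)) (y i)).val a b =
          t i a * (unip (Composition.ones (m i)) (y i)).val a b := by
        intro i a b
        rw [Units.val_mul, diagGL_val, Matrix.diagonal_mul]
      choose t' ht' hanti hlex heq using fun i => exists_maxCompactRel_diagGL_of_upper
        (diagGL (t i) * unip (Composition.ones (m i)) (y i))
        (fun a b hab => by rw [hent, unip_ones_apply_of_gt _ hab, mul_zero])
      simp only [hent, unip_apply_self, mul_one] at hlex heq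
      have hmem : (fun i a => ‖(t' i a : F)‖) ∈ S := ⟨t', rfl, by rwa [hrel _ _ ht']⟩
      have hle := Pi.toLex_monotone (β := fun i => Lex (Fin (m i) → ℝ))
        (show (fun i => toLex fun a => ‖(t i a : F)‖) ≤ fun i => toLex fun a => ‖(t' i a : F)‖
          from hlex)
      have heq' := le_antisymm hle (hmax hmem hle)
      refine hy fun i _ p _ => ?_
      have h1 := heq i (fun a => congrFun (congrFun heq' i) a) p.1.1 p.1.2
      rw [unip_apply_of_lt _ _ p.2, norm_mul] at h1
      have h2 : 0 < ‖(t i p.1.1 : F)‖ := norm_pos_iff.2 (t i p.1.1).ne_zero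
      rw [mem_closedBall_zero_iff]
      exact le_of_mul_le_mul_left (by simpa using h1) h2
  -- The integral is now the value at `t` times the measure `1` of the integral unipotents.
  have h0 := hint t
  simp_rw [hval] at h0
  rw [integral_indicator_const] at h0
  · rw [measureReal_def, Measure.pi_pi] at h0
    simp_rw [Measure.pi_pi, haarF_closedBall] at h0
    simp at h0
    exact ht h0
  · exact MeasurableSet.univ_pi fun i => MeasurableSet.univ_pi fun _ =>
      Metric.isClosed_closedBall.measurableSet

end SatakeInjectivity

/-! ### The Levi subgroup, its action on `Lie N`, and the modular character -/

section LeviEmbedding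

variable {F : Type*} [NontriviallyNormedField F] {n : ℕ} (c : Composition n)

theorem lt_of_index_lt {a b : Fin n} (h : c.index a < c.index b) : a < b := by
  have h1 : c.sizeUpTo (c.index a + 1) ≤ c.sizeUpTo (c.index b) := c.monotone_sizeUpTo h
  exact Fin.lt_def.2 ((c.lt_sizeUpTo_index_succ a).trans_le (h1.trans (c.sizeUpTo_index_le b)))

theorem exists_eq_embedding (a : Fin n) : ∃ i p, a = c.embedding i p :=
  ⟨c.index a, c.invEmbedding a, (c.embedding_comp_inv a).symm⟩

theorem leviEmb_apply (m : Levi F c) (a b : Fin n) : (leviEmb c m).val a b =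
    Matrix.blockDiagonal' (fun i => (m i).val) (c.blocksFinEquiv.symm a)
      (c.blocksFinEquiv.symm b) := rfl

theorem blocksFinEquiv_symm_embedding (i : Fin c.length) (p : Fin (c.blocksFun i)) :
    c.blocksFinEquiv.symm (c.embedding i p) = ⟨i, p⟩ :=
  c.blocksFinEquiv.symm_apply_eq.2 rfl

theorem leviEmb_apply_embedding (m : Levi F c) (i : Fin c.length) (p q : Fin (c.blocksFun i)) :
    (leviEmb c m).val (c.embedding i p) (c.embedding i q) = (m i).val p q := by
  rw [leviEmb_apply, blocksFinEquiv_symm_embedding, blocksFinEquiv_symm_embedding,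
    Matrix.blockDiagonal'_apply_eq]

theorem leviEmb_apply_ne (m : Levi F c) {a b : Fin n} (h : c.index a ≠ c.index b) :
    (leviEmb c m).val a b = 0 := by
  rw [leviEmb_apply]
  exact Matrix.blockDiagonal'_apply_ne _ _ _ h

theorem leviEmb_inv_apply_ne (m : Levi F c) {a b : Fin n} (h : c.index a ≠ c.index b) :
    (leviEmb c m)⁻¹.val a b = 0 := by
  rw [← map_inv]
  exact leviEmb_apply_ne c _ h

theorem leviEmb_norm_le (m : Levi F c) {C : ℝ} (hC : 0 ≤ C)
    (h : ∀ i p q, ‖(m i).val p q‖ ≤ C) (a b : Fin n) : ‖(leviEmb c m).val a b‖ ≤ C := by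
  obtain ⟨i, p, rfl⟩ := exists_eq_embedding c a
  obtain ⟨j, q, rfl⟩ := exists_eq_embedding c b
  by_cases hij : i = j
  · subst hij
    rw [leviEmb_apply_embedding]
    exact h i p q
  · rw [leviEmb_apply_ne _ _ (by simpa using hij)]
    simpa using hC

theorem leviEmb_mem_maxCompact [IsUltrametricDist F] {m : Levi F c}
    (h : ∀ i, m i ∈ maxCompact F (c.blocksFun i)) : leviEmb c m ∈ maxCompact F n := by
  refine mem_maxCompact_of_integral (leviEmb_norm_le c m zero_le_one fun i =>
    norm_apply_le_one_of_mem_maxCompact (h i)) ?_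
  rw [← map_inv]
  exact leviEmb_norm_le c _ zero_le_one fun i =>
    norm_apply_le_one_of_mem_maxCompact (inv_mem (h i))

theorem torusToLevi_apply (t : Fin n → Fˣ) (i : Fin c.length) :
    torusToLevi c t i = diagGL fun p => t (c.embedding i p) := rfl

theorem leviEmb_torusToLevi (t : Fin n → Fˣ) : leviEmb c (torusToLevi c t) = diagGL t := by
  ext a b
  obtain ⟨i, p, rfl⟩ := exists_eq_embedding c a
  obtain ⟨j, q, rfl⟩ := exists_eq_embedding c b
  by_cases hij : i = j
  · subst hij
    rw [leviEmb_apply_embedding, torusToLevi_apply]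
    simp [Matrix.diagonal_apply]
  · rw [leviEmb_apply_ne _ _ (by simpa using hij), diagGL_val, Matrix.diagonal_apply_ne]
    intro h
    have := congrArg c.index h
    simp [hij] at this

theorem exists_torusToLevi_eq (t : ∀ i, Fin (c.blocksFun i) → Fˣ) :
    ∃ s : Fin n → Fˣ, (torusToLevi c s = fun i => diagGL (t i)) ∧
      ∀ i p, s (c.embedding i p) = t i p := by
  let s : Fin n → Fˣ := fun a => t (c.blocksFinEquiv.symm a).1 (c.blocksFinEquiv.symm a).2
  have h : ∀ i p, s (c.embedding i p) = t i p := by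
    intro i p
    have : ∀ x : Σ i, Fin (c.blocksFun i), x = ⟨i, p⟩ → t x.1 x.2 = t i p := by
      rintro _ rfl; rfl
    exact this _ (blocksFinEquiv_symm_embedding c i p)
  refine ⟨s, funext fun i => ?_, h⟩
  rw [torusToLevi_apply]
  exact congrArg diagGL (funext (h i))

/-- The strictly block upper triangular matrix with entries `x`. -/
def upperMatrix (x : UpperPos c → F) : Matrix (Fin n) (Fin n) F :=
  Matrix.of fun a b => if h : c.index a < c.index b then x ⟨(a, b), h⟩ else 0

theorem unip_val (x : UpperPos c → F) : (unip c x).val = 1 + upperMatrix c x := rfl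

theorem upperMatrix_apply_of_lt (x : UpperPos c → F) {a b : Fin n} (h : c.index a < c.index b) :
    upperMatrix c x a b = x ⟨(a, b), h⟩ := by
  simp [upperMatrix, h]

theorem upperMatrix_apply_of_not_lt (x : UpperPos c → F) {a b : Fin n}
    (h : ¬ c.index a < c.index b) : upperMatrix c x a b = 0 := by
  simp [upperMatrix, h]

theorem sum_upperPos (f : Fin n → Fin n → F) (hf : ∀ a b, ¬ c.index a < c.index b → f a b = 0) :
    ∑ p : UpperPos c, f p.1.1 p.1.2 = ∑ a, ∑ b, f a b := by
  rw [← Fintype.sum_prod_type', ← Finset.sum_subtype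
    (Finset.univ.filter fun x : Fin n × Fin n => c.index x.1 < c.index x.2) (by simp)
    (fun x : Fin n × Fin n => f x.1 x.2), Finset.sum_filter]
  refine Finset.sum_congr rfl fun x _ => ?_
  split_ifs with h
  · rfl
  · exact (hf _ _ h).symm

/-- The matrix of `X ↦ A X B` on strictly block upper triangular matrices. -/
def biMatrix (A B : Matrix (Fin n) (Fin n) F) : Matrix (UpperPos c) (UpperPos c) F :=
  Matrix.of fun x y => A x.1.1 y.1.1 * B y.1.2 x.1.2

theorem adMatrix_eq (m : Levi F c) :
    adMatrix c m = biMatrix c (leviEmb c m).val (leviEmb c m)⁻¹.val := rfl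

/-- Block diagonal `A` and `B` preserve strict block upper triangularity, so the terms at positions
outside `UpperPos c` vanish and the sum over it may be extended to all pairs, where it factors. -/
theorem biMatrix_mul {A B : Matrix (Fin n) (Fin n) F}
    (hA : ∀ a b, c.index a ≠ c.index b → A a b = 0)
    (hB : ∀ a b, c.index a ≠ c.index b → B a b = 0) (A' B' : Matrix (Fin n) (Fin n) F) :
    biMatrix c A B * biMatrix c A' B' = biMatrix c (A * A') (B' * B) := by
  ext x y
  simp only [Matrix.mul_apply, biMatrix, Matrix.of_apply]
  rw [sum_upperPos c (fun a b => A x.1.1 a * B b x.1.2 * (A' a y.1.1 * B' y.1.2 b)),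
    Finset.sum_mul_sum]
  · exact Finset.sum_congr rfl fun a _ => Finset.sum_congr rfl fun b _ => by ring
  · intro a b h
    by_cases h1 : c.index x.1.1 = c.index a
    · have h2 : c.index b ≠ c.index x.1.2 := fun h2 => h (by rw [← h1, h2]; exact x.2)
      rw [hB _ _ h2]; ring
    · rw [hA _ _ h1]; ring

theorem biMatrix_one : biMatrix c (1 : Matrix (Fin n) (Fin n) F) 1 = 1 := by
  ext x y
  simp only [biMatrix, Matrix.of_apply, Matrix.one_apply]
  by_cases h : x = y
  · simp [h]
  · have : ¬ (x.1.1 = y.1.1 ∧ x.1.2 = y.1.2) := fun h' => h (Subtype.ext (Prod.ext h'.1 h'.2))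
    simp only [h, if_false]
    split_ifs <;> simp_all

theorem upperMatrix_biMatrix_mulVec {A B : Matrix (Fin n) (Fin n) F}
    (hA : ∀ a b, c.index a ≠ c.index b → A a b = 0)
    (hB : ∀ a b, c.index a ≠ c.index b → B a b = 0) (x : UpperPos c → F) :
    upperMatrix c ((biMatrix c A B).mulVec x) = A * upperMatrix c x * B := by
  ext a b
  have hR : (A * upperMatrix c x * B) a b =
      ∑ a', ∑ b', A a a' * upperMatrix c x a' b' * B b' b := by
    rw [Matrix.mul_apply, Finset.sum_comm]
    simp_rw [Matrix.mul_apply, Finset.sum_mul]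
  rw [hR]
  by_cases h : c.index a < c.index b
  · rw [upperMatrix_apply_of_lt c _ h, ← sum_upperPos c
      (fun a' b' => A a a' * upperMatrix c x a' b' * B b' b)]
    · simp only [Matrix.mulVec, dotProduct, biMatrix, Matrix.of_apply]
      refine Finset.sum_congr rfl fun y _ => ?_
      rw [upperMatrix_apply_of_lt c x y.2]; ring
    · intro a' b' h'
      rw [upperMatrix_apply_of_not_lt c x h']; ring
  · rw [upperMatrix_apply_of_not_lt c _ h]
    refine (Finset.sum_eq_zero fun a' _ => Finset.sum_eq_zero fun b' _ => ?_).symm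
    by_cases h1 : c.index a = c.index a'
    · by_cases h2 : c.index b' = c.index b
      · rw [upperMatrix_apply_of_not_lt c x (by rwa [← h1, h2])]; ring
      · rw [hB _ _ h2]; ring
    · rw [hA _ _ h1]; ring

/-- `M` normalises `N`, and in matrix coordinates conjugation is the linear map `adMatrix`. -/
theorem leviEmb_mul_unip (m : Levi F c) (x : UpperPos c → F) :
    leviEmb c m * unip c x = unip c ((adMatrix c m).mulVec x) * leviEmb c m := by
  refine Units.ext ?_
  rw [Units.val_mul, Units.val_mul, unip_val, unip_val, adMatrix_eq,
    upperMatrix_biMatrix_mulVec c (fun _ _ => leviEmb_apply_ne c m)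
      (fun _ _ => leviEmb_inv_apply_ne c m), mul_add, add_mul, mul_assoc _ _ (leviEmb c m).val,
    Units.inv_mul]
  simp

theorem leviEmb_mul_unip_val (m : Levi F c) (x : UpperPos c → F) :
    (leviEmb c m * unip c x).val =
      (leviEmb c m).val + upperMatrix c ((biMatrix c (leviEmb c m).val 1).mulVec x) := by
  rw [upperMatrix_biMatrix_mulVec c (fun _ _ => leviEmb_apply_ne c m)
      (fun _ _ h => Matrix.one_apply_ne fun h' => h (congrArg _ h')), Units.val_mul, unip_val]
  simp [mul_add]

theorem adMatrix_mul (m m' : Levi F c) : adMatrix c (m * m') = adMatrix c m * adMatrix c m' := by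
  rw [adMatrix_eq, adMatrix_eq, adMatrix_eq, biMatrix_mul c (fun _ _ => leviEmb_apply_ne c m)
      (fun _ _ => leviEmb_inv_apply_ne c m), map_mul, mul_inv_rev]
  rfl

theorem adMatrix_one : adMatrix c (1 : Levi F c) = 1 := by
  rw [adMatrix_eq, map_one, inv_one]
  exact biMatrix_one c

theorem modular_mul (m m' : Levi F c) : modular c (m * m') = modular c m * modular c m' := by
  rw [modular, adMatrix_mul, Matrix.det_mul, norm_mul]; rfl

theorem modular_one : modular c (1 : Levi F c) = 1 := by
  rw [modular, adMatrix_one, Matrix.det_one, norm_one]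

theorem modular_pos (m : Levi F c) : 0 < modular c m := by
  have h := modular_mul c m m⁻¹
  rw [mul_inv_cancel, modular_one] at h
  refine lt_of_le_of_ne (norm_nonneg _) fun h0 => ?_
  rw [← h0, zero_mul] at h
  exact one_ne_zero h

/-- Both `m` and `m⁻¹` act on `Lie N` by integral matrices, so both moduli are at most `1`, while
their product is `1`. -/
theorem modular_of_mem_maxCompact [IsUltrametricDist F] {m : Levi F c}
    (h : ∀ i, m i ∈ maxCompact F (c.blocksFun i)) : modular c m = 1 := by
  have key : ∀ m : Levi F c, (∀ i, m i ∈ maxCompact F (c.blocksFun i)) → modular c m ≤ 1 := by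
    intro m h
    have hk := leviEmb_mem_maxCompact c h
    refine norm_det_le_one fun x y => ?_
    rw [adMatrix_eq, biMatrix, Matrix.of_apply, norm_mul]
    exact mul_le_one₀ (norm_apply_le_one_of_mem_maxCompact hk _ _) (norm_nonneg _)
      (norm_apply_le_one_of_mem_maxCompact (inv_mem hk) _ _)
  have h1 := key m h
  have h2 := key m⁻¹ fun i => inv_mem (h i)
  have h3 := modular_mul c m m⁻¹
  rw [mul_inv_cancel, modular_one] at h3
  nlinarith [modular_pos c m]

theorem modular_torusToLevi (t : Fin n → Fˣ) : modular c (torusToLevi c t) =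
    ∏ p : UpperPos c, ‖(t p.1.1 : F)‖ / ‖(t p.1.2 : F)‖ := by
  have h : adMatrix c (torusToLevi c t) =
      Matrix.diagonal fun p : UpperPos c => (t p.1.1 : F) * (t p.1.2 : F)⁻¹ := by
    rw [adMatrix_eq, leviEmb_torusToLevi, diagGL_inv]
    ext x y
    simp only [biMatrix, diagGL_val, Matrix.of_apply, Matrix.diagonal_apply]
    by_cases h : x = y
    · simp [h]
    · have : ¬ (x.1.1 = y.1.1 ∧ x.1.2 = y.1.2) := fun h' => h (Subtype.ext (Prod.ext h'.1 h'.2))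
      simp only [h, if_false]
      split_ifs <;> simp_all
  rw [modular, h, Matrix.det_diagonal, norm_prod]
  simp [div_eq_mul_inv]

theorem diagGL_mul_unip_mul_inv (s : Fin n → Fˣ) (x : UpperPos c → F) :
    diagGL s * unip c x * (diagGL s)⁻¹ =
      unip c fun p => s p.1.1 * x p * (s p.1.2 : F)⁻¹ := by
  ext a b
  rw [diagGL_inv, Units.val_mul, Units.val_mul, diagGL_val, diagGL_val, Matrix.mul_diagonal,
    Matrix.diagonal_mul]
  by_cases h : c.index a < c.index b
  · rw [unip_apply_of_lt c _ h, unip_apply_of_lt c _ h]; simp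
  · rw [unip_apply_of_not_lt c _ h, unip_apply_of_not_lt c _ h, Matrix.one_apply]
    split_ifs with h'
    · simp [h']
    · simp

/-- Conjugation by a suitable torus element contracts `N`, bringing any given element into the
maximal compact subgroup. This transfers facts about compact elements to arbitrary unipotents. -/
theorem exists_unip_eq_conj [IsUltrametricDist F] (x : UpperPos c → F) :
    ∃ s : Fin n → Fˣ, ∃ k ∈ maxCompact F n, unip c x = (diagGL s)⁻¹ * k * diagGL s := by
  obtain ⟨y, hy0, hy1⟩ := NormedField.exists_norm_lt_one F
  set R : ℝ := ‖x‖ + 1 with hR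
  have hR0 : 0 < R := by positivity
  obtain ⟨N, hN⟩ := exists_pow_lt_of_lt_one (inv_pos.2 hR0) hy1
  set z : F := y ^ N with hz
  have hz0 : z ≠ 0 := pow_ne_zero _ (norm_pos_iff.1 hy0)
  have hzpos : 0 < ‖z‖ := norm_pos_iff.2 hz0
  have hz1 : ‖z‖ ≤ 1 := by rw [hz, norm_pow]; exact pow_le_one₀ hy0.le hy1.le
  have hzR : ‖z‖ * R ≤ 1 := by
    rw [hz, norm_pow]
    calc ‖y‖ ^ N * R ≤ R⁻¹ * R := by gcongr
      _ = 1 := inv_mul_cancel₀ hR0.ne'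
  -- Conjugation by `s` multiplies the entry at `(a, b)` by `z ^ (b - a)`. Here `b > a`, and one
  -- factor `z` already makes the entry integral.
  let s : Fin n → Fˣ := fun a => (Units.mk0 z hz0 ^ (a : ℕ))⁻¹
  refine ⟨s, _, unip_mem_maxCompact (x := fun p => s p.1.1 * x p * (s p.1.2 : F)⁻¹)
    fun p => ?_, ?_⟩
  · have hlt : (p.1.1 : ℕ) < p.1.2 := lt_of_index_lt c p.2
    have h1 : ‖z‖ ^ (p.1.2 : ℕ) ≤ ‖z‖ ^ (p.1.1 : ℕ) * ‖z‖ := by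
      rw [← pow_succ]
      exact pow_le_pow_of_le_one hzpos.le hz1 hlt
    have h2 : ‖x p‖ ≤ R := (norm_le_pi_norm x p).trans (by rw [hR]; linarith)
    have h3 : 0 < ‖z‖ ^ (p.1.1 : ℕ) := pow_pos hzpos _
    simp only [s, Units.val_inv_eq_inv_val, Units.val_pow_eq_pow_val, Units.val_mk0, norm_mul,
      norm_inv, norm_pow, inv_inv]
    calc (‖z‖ ^ (p.1.1 : ℕ))⁻¹ * ‖x p‖ * ‖z‖ ^ (p.1.2 : ℕ)
        ≤ (‖z‖ ^ (p.1.1 : ℕ))⁻¹ * R * (‖z‖ ^ (p.1.1 : ℕ) * ‖z‖) := by gcongr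
      _ = ‖z‖ * R := by field_simp
      _ ≤ 1 := hzR
  · rw [← diagGL_mul_unip_mul_inv]; group

/-- A tuple of upper triangular unipotent matrices. -/
def unipLevi (y : ∀ i, UpperPos (Composition.ones (c.blocksFun i)) → F) : Levi F c :=
  fun i => unip (Composition.ones (c.blocksFun i)) (y i)

theorem exists_unipLevi_eq_conj [IsUltrametricDist F]
    (y : ∀ i, UpperPos (Composition.ones (c.blocksFun i)) → F) :
    ∃ s : Fin n → Fˣ, ∃ k : Levi F c, (∀ i, k i ∈ maxCompact F (c.blocksFun i)) ∧
      unipLevi c y = (torusToLevi c s)⁻¹ * k * torusToLevi c s := by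
  choose s k hk h using fun i => exists_unip_eq_conj (Composition.ones (c.blocksFun i)) (y i)
  obtain ⟨t, ht, -⟩ := exists_torusToLevi_eq c s
  exact ⟨t, k, hk, by rw [ht]; exact funext h⟩

theorem modular_unipLevi [IsUltrametricDist F]
    (y : ∀ i, UpperPos (Composition.ones (c.blocksFun i)) → F) :
    modular c (unipLevi c y) = 1 := by
  obtain ⟨s, k, hk, h⟩ := exists_unipLevi_eq_conj c y
  have h1 := modular_mul c (torusToLevi c s)⁻¹ (torusToLevi c s)
  rw [inv_mul_cancel, modular_one] at h1
  rw [h, modular_mul, modular_mul, modular_of_mem_maxCompact c hk, mul_one, ← h1]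

/-- The positions above the diagonal lie either in a diagonal block or above the diagonal
blocks. -/
noncomputable def upperPosEquiv :
    (Σ i, UpperPos (Composition.ones (c.blocksFun i))) ⊕ UpperPos c ≃
      UpperPos (Composition.ones n) :=
  Equiv.ofBijective
    (Sum.elim
      (fun x => ⟨(c.embedding x.1 x.2.1.1, c.embedding x.1 x.2.1.2), by
        rw [ones_index_lt_iff, OrderEmbedding.lt_iff_lt, ← ones_index_lt_iff]; exact x.2.2⟩)
      (fun x => ⟨x.1, ones_index_lt_iff.2 (lt_of_index_lt c x.2)⟩)) (by
    constructor
    · rintro (⟨i, ⟨⟨p, q⟩, hp⟩⟩ | ⟨⟨a, b⟩, h⟩) (⟨j, ⟨⟨p', q'⟩, hp'⟩⟩ | ⟨⟨a', b'⟩, h'⟩) heq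
      · simp only [Sum.elim_inl, Subtype.mk.injEq, Prod.mk.injEq] at heq
        have hij := congrArg c.index heq.1
        rw [c.index_embedding, c.index_embedding] at hij
        subst hij
        obtain ⟨h1, h2⟩ := heq
        obtain rfl := (c.embedding i).injective h1
        obtain rfl := (c.embedding i).injective h2
        rfl
      · simp only [Sum.elim_inl, Sum.elim_inr, Subtype.mk.injEq, Prod.mk.injEq] at heq
        simp [← heq.1, ← heq.2] at h'
      · simp only [Sum.elim_inl, Sum.elim_inr, Subtype.mk.injEq, Prod.mk.injEq] at heq
        simp [heq.1, heq.2] at h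
      · simp only [Sum.elim_inr, Subtype.mk.injEq, Prod.mk.injEq] at heq
        obtain ⟨rfl, rfl⟩ := heq
        rfl
    · rintro ⟨⟨a, b⟩, hab⟩
      by_cases h : c.index a < c.index b
      · exact ⟨Sum.inr ⟨(a, b), h⟩, rfl⟩
      · have hlt := ones_index_lt_iff.1 hab
        have hidx : c.index a = c.index b := by
          refine le_antisymm ?_ (not_lt.1 h)
          by_contra! h'
          exact absurd (lt_of_index_lt c h') hlt.asymm
        obtain ⟨i, p, rfl⟩ := exists_eq_embedding c a
        obtain ⟨j, q, rfl⟩ := exists_eq_embedding c b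
        rw [c.index_embedding, c.index_embedding] at hidx
        subst hidx
        exact ⟨Sum.inl ⟨i, ⟨(p, q), ones_index_lt_iff.2 ((c.embedding i).lt_iff_lt.1 hlt)⟩⟩, rfl⟩)

/-- The positive roots of the torus are those inside the blocks of `M` together with those in `N`.
-/
theorem modular_ones_torusToLevi (t : Fin n → Fˣ) :
    modular (Composition.ones n) (torusToLevi (Composition.ones n) t) =
      (∏ i, modular (Composition.ones (c.blocksFun i))
        (torusToLevi (Composition.ones (c.blocksFun i)) fun p => t (c.embedding i p))) *
        modular c (torusToLevi c t) := by
  simp_rw [modular_torusToLevi]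
  rw [← (upperPosEquiv c).prod_comp, Fintype.prod_sum_type, Fintype.prod_sigma]
  rfl

end LeviEmbedding

/-! ### Linear maps preserving Haar measure -/

section HaarPreserving

/-- By uniqueness of Haar measure, it suffices to compare the two measures on a single compact set
with nonempty interior. -/
theorem measurePreserving_of_positiveCompacts {G H : Type*} [AddCommGroup G] [TopologicalSpace G]
    [IsTopologicalAddGroup G] [MeasurableSpace G] [BorelSpace G]
    [AddCommGroup H] [TopologicalSpace H] [IsTopologicalAddGroup H] [MeasurableSpace H]
    [BorelSpace H] [SecondCountableTopology H] (e : G ≃ₜ+ H) (μ : Measure G)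
    (ν : Measure H) [μ.IsAddHaarMeasure] [ν.IsAddHaarMeasure] [SigmaFinite ν]
    [SigmaFinite (μ.map e)]
    (K : TopologicalSpace.PositiveCompacts H) (h : μ (e ⁻¹' K) = ν K) :
    MeasurePreserving e μ ν := by
  have hmeas : Measurable e := e.toHomeomorph.measurable
  refine ⟨hmeas, ?_⟩
  have := ContinuousAddEquiv.isAddHaarMeasure_map μ e
  have hK : (μ.map e) K = ν K := by
    rw [← h]
    exact e.toHomeomorph.measurableEmbedding.map_apply _ _
  rw [Measure.addHaarMeasure_unique (μ.map e) K, hK]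
  exact (Measure.addHaarMeasure_unique ν K).symm

variable {F : Type*} [NontriviallyNormedField F] [ProperSpace F]

/-- A product of closed balls. -/
def weightedBox (F : Type*) [NontriviallyNormedField F] [ProperSpace F] {ι : Type*} [Fintype ι]
    {r : ι → ℝ} (hr : ∀ i, 0 < r i) : TopologicalSpace.PositiveCompacts (ι → F) where
  carrier := Set.univ.pi fun i => Metric.closedBall 0 (r i)
  isCompact' := isCompact_univ_pi fun i => isCompact_closedBall 0 (r i)
  interior_nonempty' := by
    rw [interior_pi_set Set.finite_univ]
    exact ⟨0, fun i _ => Metric.ball_subset_interior_closedBall (Metric.mem_ball_self (hr i))⟩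

variable [IsUltrametricDist F] [MeasurableSpace F] [BorelSpace F] {ι : Type*} [Fintype ι]
  [DecidableEq ι]

theorem mulVec_mem_weightedBox {A : Matrix ι ι F} {r : ι → ℝ} (hr : ∀ i, 0 < r i)
    (hA : ∀ i j, ‖A i j‖ * r j ≤ r i) {x : ι → F} (hx : ∀ i, ‖x i‖ ≤ r i) (i : ι) :
    ‖A.mulVec x i‖ ≤ r i := by
  refine IsUltrametricDist.norm_sum_le_of_forall_le_of_nonneg (hr i).le fun j _ => ?_
  rw [norm_mul]
  exact (mul_le_mul_of_nonneg_left (hx j) (norm_nonneg _)).trans (hA i j)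

/-- An invertible matrix preserving a box preserves the Haar measure. -/
theorem integral_comp_mulVec {A B : Matrix ι ι F} (hAB : A * B = 1) (hBA : B * A = 1) {r : ι → ℝ}
    (hr : ∀ i, 0 < r i) (hA : ∀ i j, ‖A i j‖ * r j ≤ r i) (hB : ∀ i j, ‖B i j‖ * r j ≤ r i)
    (f : (ι → F) → ℂ) :
    ∫ x, f (A.mulVec x) ∂(Measure.pi fun _ => haarF F) =
      ∫ x, f x ∂(Measure.pi fun _ => haarF F) := by
  let e : (ι → F) ≃ₜ+ (ι → F) :=
    { toFun := A.mulVec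
      invFun := B.mulVec
      left_inv := fun x => by rw [Matrix.mulVec_mulVec, hBA, Matrix.one_mulVec]
      right_inv := fun x => by rw [Matrix.mulVec_mulVec, hAB, Matrix.one_mulVec]
      map_add' := Matrix.mulVec_add A
      continuous_toFun := Continuous.matrix_mulVec continuous_const continuous_id
      continuous_invFun := Continuous.matrix_mulVec continuous_const continuous_id }
  have : SigmaFinite ((Measure.pi fun _ : ι => haarF F).map e) := by
    have := ContinuousAddEquiv.isAddHaarMeasure_map (Measure.pi fun _ : ι => haarF F) e
    infer_instance
  have hpre : e ⁻¹' (weightedBox F hr : Set (ι → F)) = weightedBox F hr := by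
    have hmem : ∀ x : ι → F, x ∈ (weightedBox F hr : Set (ι → F)) ↔ ∀ i, ‖x i‖ ≤ r i := by
      intro x
      change x ∈ Set.univ.pi (fun i => Metric.closedBall 0 (r i)) ↔ _
      simp
    ext x
    rw [Set.mem_preimage, hmem, hmem]
    refine ⟨fun h => ?_, fun h => mulVec_mem_weightedBox hr hA h⟩
    have h1 := mulVec_mem_weightedBox hr hB h
    rwa [show B.mulVec (e x) = x from e.left_inv x] at h1
  exact (measurePreserving_of_positiveCompacts e _ _ (weightedBox F hr)
    (congrArg _ hpre)).integral_comp e.toHomeomorph.measurableEmbedding f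

end HaarPreserving

/-! ### Integrability over unipotent radicals -/

section Integrability

variable {F : Type*} [NontriviallyNormedField F] {n : ℕ} (c : Composition n)

theorem continuous_upperMatrix : Continuous (upperMatrix (F := F) c) := by
  refine continuous_matrix fun a b => ?_
  by_cases h : c.index a < c.index b
  · simp_rw [upperMatrix_apply_of_lt c _ h]
    fun_prop
  · simp_rw [upperMatrix_apply_of_not_lt c _ h]
    fun_prop

theorem continuous_unip : Continuous (unip (F := F) c) := by
  have h : Continuous fun x => (unip (F := F) c x).val := by
    simp_rw [unip_val]
    exact continuous_const.add (continuous_upperMatrix c)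
  refine Units.continuous_iff.2 ⟨h, ?_⟩
  have h2 : (fun x => ((unip (F := F) c x)⁻¹).val) = fun x => (unip c x).val.adjugate := by
    funext x
    rw [Matrix.coe_units_inv, Matrix.inv_def, show (unip c x).val.det = 1 from det_unipMatrix c x]
    simp
  rw [h2]
  exact h.matrix_adjugate

theorem continuous_GL_apply (a b : Fin n) : Continuous fun g : GL (Fin n) F => g.val a b :=
  (continuous_id.matrix_elem a b).comp Units.continuous_val

/-- Reading off matrix entries is a continuous left inverse. Closedness is what makes the
restriction of a compactly supported function to a coset of `N` compactly supported. -/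
theorem isClosedEmbedding_unip : Topology.IsClosedEmbedding (unip (F := F) c) := by
  refine Function.LeftInverse.isClosedEmbedding
    (f := fun (g : GL (Fin n) F) (p : UpperPos c) => g.val p.1.1 p.1.2) (fun x => ?_)
    (continuous_pi fun p => continuous_GL_apply _ _) (continuous_unip c)
  exact funext fun p => unip_apply_of_lt c x p.2

variable {f : GL (Fin n) F → ℂ}

theorem IsHecke.integrable_unip [ProperSpace F] [MeasurableSpace F] [BorelSpace F]
    (hf : IsHecke f) (g : GL (Fin n) F) :
    Integrable (fun x => f (g * unip c x)) (Measure.pi fun _ => haarF F) := by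
  refine Continuous.integrable_of_hasCompactSupport ?_ ?_
  · exact hf.locConst.continuous.comp (continuous_const.mul (continuous_unip c))
  · exact hf.compactSupport.comp_isClosedEmbedding
      ((Homeomorph.mulLeft g).isClosedEmbedding.comp (isClosedEmbedding_unip c))

theorem IsHecke.exists_bound (hf : IsHecke f) :
    ∃ C : ℝ, ∀ g, f g ≠ 0 → ∀ a b, ‖g.val a b‖ ≤ C ∧ ‖(g⁻¹).val a b‖ ≤ C := by
  have key : ∀ φ : GL (Fin n) F → F, Continuous φ → ∃ C : ℝ, ∀ g, f g ≠ 0 → ‖φ g‖ ≤ C := by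
    intro φ hφ
    obtain ⟨C, hC⟩ := (hf.compactSupport.isCompact.image hφ).isBounded.exists_norm_le
    exact ⟨C, fun g hg => hC _ ⟨g, subset_tsupport f hg, rfl⟩⟩
  choose C hC using fun a b => key _ (continuous_GL_apply (F := F) (n := n) a b)
  choose D hD using fun a b =>
    key _ ((continuous_GL_apply (F := F) (n := n) a b).comp continuous_inv)
  refine ⟨∑ a, ∑ b, (|C a b| + |D a b|), fun g hg a b => ?_⟩
  have h : |C a b| + |D a b| ≤ ∑ a, ∑ b, (|C a b| + |D a b|) :=
    (Finset.single_le_sum (f := fun b => |C a b| + |D a b|)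
      (fun b _ => by positivity) (Finset.mem_univ b)).trans
    (Finset.single_le_sum (f := fun a => ∑ b, (|C a b| + |D a b|))
      (fun a _ => Finset.sum_nonneg fun b _ => by positivity) (Finset.mem_univ a))
  exact ⟨by linarith [hC a b g hg, le_abs_self (C a b), abs_nonneg (D a b)],
    by linarith [show ‖(g⁻¹).val a b‖ ≤ D a b from hD a b g hg, le_abs_self (D a b),
      abs_nonneg (C a b)]⟩

end Integrability

/-! ### Invariance, support and transitivity of constant terms -/

section ConstantTerm

variable {F : Type*} [NontriviallyNormedField F] [IsUltrametricDist F] [ProperSpace F]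
  [MeasurableSpace F] [BorelSpace F] {n : ℕ} (c : Composition n) {f : GL (Fin n) F → ℂ}

/-- Moving `k₂` to the right across `N` substitutes `adMatrix c k₂` in the integration variable.
This matrix and its inverse are integral, so the substitution preserves the unit box and hence the
measure. -/
theorem constantTerm_bi_invariant (hf : IsUnramified f) (k₁ k₂ m : Levi F c)
    (h₁ : ∀ i, k₁ i ∈ maxCompact F (c.blocksFun i))
    (h₂ : ∀ i, k₂ i ∈ maxCompact F (c.blocksFun i)) :
    constantTerm c f (k₁ * m * k₂) = constantTerm c f m := by
  have hA : ∀ k : Levi F c, (∀ i, k i ∈ maxCompact F (c.blocksFun i)) →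
      ∀ x y, ‖adMatrix c k x y‖ * 1 ≤ 1 := by
    intro k hk x y
    have hk' := leviEmb_mem_maxCompact c hk
    rw [adMatrix_eq, biMatrix, Matrix.of_apply, norm_mul, mul_one]
    exact mul_le_one₀ (norm_apply_le_one_of_mem_maxCompact hk' _ _) (norm_nonneg _)
      (norm_apply_le_one_of_mem_maxCompact (inv_mem hk') _ _)
  rw [constantTerm, constantTerm, modular_mul, modular_mul, modular_of_mem_maxCompact c h₁,
    modular_of_mem_maxCompact c h₂, one_mul, mul_one]
  congr 1
  rw [← integral_comp_mulVec (A := adMatrix c k₂) (B := adMatrix c k₂⁻¹) (r := fun _ => 1)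
    (by rw [← adMatrix_mul, mul_inv_cancel, adMatrix_one])
    (by rw [← adMatrix_mul, inv_mul_cancel, adMatrix_one]) (fun _ => one_pos) (hA k₂ h₂)
    (hA k₂⁻¹ fun i => inv_mem (h₂ i)) (fun x => f (leviEmb c m * unip c x))]
  refine integral_congr_ae (Filter.Eventually.of_forall fun x => ?_)
  have h : leviEmb c (k₁ * m * k₂) * unip c x =
      leviEmb c k₁ * (leviEmb c m * unip c ((adMatrix c k₂).mulVec x)) * leviEmb c k₂ := by
    rw [map_mul, map_mul, mul_assoc _ (leviEmb c k₂), leviEmb_mul_unip]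
    group
  change f _ = f _
  rw [h, hf.biInvariant _ (leviEmb_mem_maxCompact c h₁) _ (leviEmb_mem_maxCompact c h₂)]

theorem unip_inv_apply_of_index_eq (x : UpperPos c → F) {a b : Fin n}
    (hab : c.index a = c.index b) :
    (unip c x)⁻¹.val a b = (1 : Matrix (Fin n) (Fin n) F) a b := by
  have htri : Matrix.BlockTriangular (unip c x).val c.index := by
    intro i j hij
    rw [unip_apply_of_not_lt c x hij.asymm, Matrix.one_apply_ne]
    rintro rfl
    exact lt_irrefl _ hij
  have : Invertible (unip c x).val := (unip c x).invertible
  have htri' : Matrix.BlockTriangular (unip c x)⁻¹.val c.index := by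
    rw [Matrix.coe_units_inv]
    exact Matrix.blockTriangular_inv_of_blockTriangular htri
  have h1 : (unip c x)⁻¹.val + upperMatrix c x * (unip c x)⁻¹.val = 1 := by
    have := Units.mul_inv (unip c x)
    rwa [unip_val, add_mul, one_mul] at this
  rw [← h1, Matrix.add_apply, Matrix.mul_apply, Finset.sum_eq_zero, add_zero]
  intro k _
  by_cases h : c.index a < c.index k
  · rw [htri' (show c.index b < c.index k by rwa [← hab]), mul_zero]
  · rw [upperMatrix_apply_of_not_lt c x h, zero_mul]

/-- For `u` in `N`, the diagonal blocks of `m u` and `(m u)⁻¹` are those of `m` and `m⁻¹`, so they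
inherit the entry bounds on the support of `f`. -/
theorem hasBoundedSupport_constantTerm (hf : IsHecke f) :
    HasBoundedSupport (m := c.blocksFun) (constantTerm c f) := by
  obtain ⟨C, hC⟩ := hf.exists_bound
  refine ⟨C, fun m hm i p q => ?_⟩
  have hx : ∃ x, f (leviEmb c m * unip c x) ≠ 0 := by
    by_contra! h
    exact hm (by simp [constantTerm, h])
  obtain ⟨x, hx⟩ := hx
  have hb := hC _ hx (c.embedding i p) (c.embedding i q)
  refine ⟨?_, ?_⟩
  · have h1 := hb.1
    rwa [leviEmb_mul_unip_val, Matrix.add_apply, leviEmb_apply_embedding,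
      upperMatrix_apply_of_not_lt c _ (by simp), add_zero] at h1
  · have h2 := hb.2
    rw [mul_inv_rev, Units.val_mul, Matrix.mul_apply, Finset.sum_eq_single (c.embedding i p),
      unip_inv_apply_of_index_eq c x rfl, Matrix.one_apply_eq, one_mul, ← map_inv,
      leviEmb_apply_embedding] at h2
    · exact h2
    · intro k _ hk
      by_cases h : c.index (c.embedding i p) = c.index k
      · rw [unip_inv_apply_of_index_eq c x h, Matrix.one_apply_ne hk.symm, zero_mul]
      · rw [leviEmb_inv_apply_ne c m (fun h' => h (by rw [h']; simp)), mul_zero]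
    · simp

/-- The entries above the diagonal of an upper triangular matrix, assembled from those of the
diagonal blocks and those above the diagonal blocks. -/
noncomputable def joinUpper :
    (∀ i, UpperPos (Composition.ones (c.blocksFun i)) → F) × (UpperPos c → F) ≃ₜ+
      (UpperPos (Composition.ones n) → F) where
  toFun z p := Sum.elim (fun q => z.1 q.1 q.2) z.2 ((upperPosEquiv c).symm p)
  invFun w := (fun i q => w (upperPosEquiv c (Sum.inl ⟨i, q⟩)),
    fun p => w (upperPosEquiv c (Sum.inr p)))
  left_inv z := by simp
  right_inv w := by
    funext p
    obtain ⟨q | q, rfl⟩ := (upperPosEquiv c).surjective p <;> simp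
  map_add' z w := by
    funext p
    obtain ⟨q | q, rfl⟩ := (upperPosEquiv c).surjective p <;> simp
  continuous_toFun := by
    refine continuous_pi fun p => ?_
    obtain ⟨q | q, rfl⟩ := (upperPosEquiv c).surjective p <;>
      simp only [Equiv.symm_apply_apply, Sum.elim_inl, Sum.elim_inr] <;> fun_prop
  continuous_invFun := by fun_prop

theorem joinUpper_inl (z : (∀ i, UpperPos (Composition.ones (c.blocksFun i)) → F) ×
    (UpperPos c → F)) (i : Fin c.length) (q : UpperPos (Composition.ones (c.blocksFun i))) :
    joinUpper c z (upperPosEquiv c (Sum.inl ⟨i, q⟩)) = z.1 i q := by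
  change Sum.elim _ _ ((upperPosEquiv c).symm _) = _
  simp

theorem joinUpper_inr (z : (∀ i, UpperPos (Composition.ones (c.blocksFun i)) → F) ×
    (UpperPos c → F)) (q : UpperPos c) :
    joinUpper c z (upperPosEquiv c (Sum.inr q)) = z.2 q := by
  change Sum.elim _ _ ((upperPosEquiv c).symm _) = _
  simp

theorem unip_joinUpper_val (z : (∀ i, UpperPos (Composition.ones (c.blocksFun i)) → F) ×
    (UpperPos c → F)) : (unip (Composition.ones n) (joinUpper c z)).val =
      (leviEmb c (unipLevi c z.1)).val + upperMatrix c z.2 := by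
  ext a b
  rw [Matrix.add_apply]
  obtain ⟨i, p, rfl⟩ := exists_eq_embedding c a
  obtain ⟨j, q, rfl⟩ := exists_eq_embedding c b
  rcases lt_trichotomy i j with hij | rfl | hij
  · have hlt : c.index (c.embedding i p) < c.index (c.embedding j q) := by simpa using hij
    rw [leviEmb_apply_ne c _ hlt.ne, zero_add, upperMatrix_apply_of_lt c _ hlt,
      unip_apply_of_lt _ _ (ones_index_lt_iff.2 (lt_of_index_lt c hlt))]
    exact joinUpper_inr c z ⟨_, hlt⟩
  · rw [leviEmb_apply_embedding, upperMatrix_apply_of_not_lt c _ (by simp), add_zero, unipLevi]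
    by_cases hpq : p < q
    · rw [unip_apply_of_lt _ _ (ones_index_lt_iff.2 hpq),
        unip_apply_of_lt _ _ (ones_index_lt_iff.2 ((c.embedding i).lt_iff_lt.2 hpq))]
      exact joinUpper_inl c z i ⟨(p, q), ones_index_lt_iff.2 hpq⟩
    · rw [unip_apply_of_not_lt _ _ (by rwa [ones_index_lt_iff, OrderEmbedding.lt_iff_lt]),
        unip_apply_of_not_lt _ _ (by rwa [ones_index_lt_iff]),
        Matrix.one_apply, Matrix.one_apply]
      simp
  · have hlt : c.index (c.embedding j q) < c.index (c.embedding i p) := by simpa using hij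
    rw [leviEmb_apply_ne c _ hlt.ne', zero_add, upperMatrix_apply_of_not_lt c _ hlt.asymm,
      unip_ones_apply_of_gt _ (lt_of_index_lt c hlt)]

instance {l : ℕ} (m : Fin l → ℕ) : (unipMeasure F m).IsAddHaarMeasure :=
  Measure.pi.isAddHaarMeasure
    (fun i => Measure.pi fun _ : UpperPos (Composition.ones (m i)) => haarF F)

instance : ((unipMeasure F c.blocksFun).prod
    (Measure.pi fun _ : UpperPos c => haarF F)).IsAddHaarMeasure :=
  Measure.prod.instIsAddHaarMeasure _ _

/-- `joinUpper` only relabels coordinates, so the unit box corresponds to a product of unit boxes,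
all of measure `1`. -/
theorem measurePreserving_joinUpper : MeasurePreserving (joinUpper (F := F) c)
    ((unipMeasure F c.blocksFun).prod (Measure.pi fun _ => haarF F))
    (Measure.pi fun _ => haarF F) := by
  have : SigmaFinite (((unipMeasure F c.blocksFun).prod
      (Measure.pi fun _ => haarF F)).map (joinUpper (F := F) c)) := by
    have := ContinuousAddEquiv.isAddHaarMeasure_map ((unipMeasure F c.blocksFun).prod
      (Measure.pi fun _ => haarF F)) (joinUpper (F := F) c)
    infer_instance
  refine measurePreserving_of_positiveCompacts _ _ _
    (weightedBox F (r := fun _ : UpperPos (Composition.ones n) => 1) fun _ => one_pos) ?_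
  have hpre : joinUpper (F := F) c ⁻¹'
      (weightedBox F (r := fun _ : UpperPos (Composition.ones n) => 1) fun _ => one_pos) =
      (Set.univ.pi fun i => Set.univ.pi fun _ => Metric.closedBall 0 1) ×ˢ
        (Set.univ.pi fun _ => Metric.closedBall 0 1) := by
    ext z
    change joinUpper c z ∈ Set.univ.pi (fun _ => Metric.closedBall 0 1) ↔ _
    simp only [Set.mem_pi, Set.mem_univ, true_imp_iff, mem_closedBall_zero_iff, Set.mem_prod]
    refine ⟨fun h => ⟨fun i q => ?_, fun q => ?_⟩, fun h p => ?_⟩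
    · simpa [joinUpper_inl] using h (upperPosEquiv c (Sum.inl ⟨i, q⟩))
    · simpa [joinUpper_inr] using h (upperPosEquiv c (Sum.inr q))
    · obtain ⟨⟨i, q⟩ | q, rfl⟩ := (upperPosEquiv c).surjective p
      · rw [joinUpper_inl]; exact h.1 i q
      · rw [joinUpper_inr]; exact h.2 q
  rw [hpre, Measure.prod_prod, Measure.pi_pi]
  change _ = Measure.pi _ (Set.univ.pi fun _ => Metric.closedBall 0 1)
  simp_rw [Measure.pi_pi, haarF_closedBall]
  simp

/-- With `u = unipLevi c y` and `X` the strictly block upper part, `u (1 + X) = u + u X`, and the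
matrix of `joinUpper c (y, x)` is `u + X`. The two sides differ by the substitution `X ↦ u X`, which
preserves the measure. -/
theorem integral_leviEmb_mul_unip (g : GL (Fin n) F)
    (y : ∀ i, UpperPos (Composition.ones (c.blocksFun i)) → F) :
    ∫ x, f (g * leviEmb c (unipLevi c y) * unip c x) ∂(Measure.pi fun _ => haarF F) =
      ∫ x, f (g * unip (Composition.ones n) (joinUpper c (y, x)))
        ∂(Measure.pi fun _ => haarF F) := by
  obtain ⟨s, k, hk, hu⟩ := exists_unipLevi_eq_conj c y
  set u := unipLevi c y with hu'
  -- Since `u = s⁻¹ k s` with `k` integral, left multiplication by `u` preserves the box with radius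
  -- `‖s a‖⁻¹` in row `a`; the unit box itself need not be preserved.
  have hbound : ∀ k : Levi F c, (∀ i, k i ∈ maxCompact F (c.blocksFun i)) → ∀ p q : UpperPos c,
      ‖biMatrix c (leviEmb c ((torusToLevi c s)⁻¹ * k * torusToLevi c s)).val 1 p q‖ *
        ‖(s q.1.1 : F)‖⁻¹ ≤ ‖(s p.1.1 : F)‖⁻¹ := by
    intro k hk p q
    have h1 := norm_apply_le_one_of_mem_maxCompact (leviEmb_mem_maxCompact c hk) p.1.1 q.1.1
    have h2 : ‖(1 : Matrix (Fin n) (Fin n) F) q.1.2 p.1.2‖ ≤ 1 := by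
      rw [Matrix.one_apply]; split_ifs <;> simp
    have hs : ∀ a, 0 < ‖(s a : F)‖ := fun a => norm_pos_iff.2 (s a).ne_zero
    rw [map_mul, map_mul, map_inv, leviEmb_torusToLevi, diagGL_inv, biMatrix, Matrix.of_apply,
      Units.val_mul, Units.val_mul, diagGL_val, diagGL_val, Matrix.mul_diagonal,
      Matrix.diagonal_mul, norm_mul, norm_mul, norm_mul, Units.val_inv_eq_inv_val, norm_inv]
    calc ‖(s p.1.1 : F)‖⁻¹ * ‖(leviEmb c k).val p.1.1 q.1.1‖ * ‖(s q.1.1 : F)‖ *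
          ‖(1 : Matrix (Fin n) (Fin n) F) q.1.2 p.1.2‖ * ‖(s q.1.1 : F)‖⁻¹
        ≤ ‖(s p.1.1 : F)‖⁻¹ * 1 * ‖(s q.1.1 : F)‖ * 1 * ‖(s q.1.1 : F)‖⁻¹ := by gcongr
      _ = ‖(s p.1.1 : F)‖⁻¹ := by
        rw [mul_one, mul_one, mul_assoc, mul_inv_cancel₀ (hs _).ne', mul_one]
  have hone : ∀ a b : Fin n, c.index a ≠ c.index b → (1 : Matrix (Fin n) (Fin n) F) a b = 0 :=
    fun a b h => Matrix.one_apply_ne fun h' => h (congrArg _ h')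
  have hinv : u⁻¹ = (torusToLevi c s)⁻¹ * k⁻¹ * torusToLevi c s := by rw [hu]; group
  rw [← integral_comp_mulVec (A := biMatrix c (leviEmb c u).val 1)
    (B := biMatrix c (leviEmb c u⁻¹).val 1) (r := fun p => ‖(s p.1.1 : F)‖⁻¹)
    (by rw [biMatrix_mul c (fun _ _ => leviEmb_apply_ne c u) hone, ← Units.val_mul, ← map_mul,
          mul_inv_cancel, map_one, Units.val_one, mul_one, biMatrix_one])
    (by rw [biMatrix_mul c (fun _ _ => leviEmb_apply_ne c u⁻¹) hone, ← Units.val_mul, ← map_mul,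
          inv_mul_cancel, map_one, Units.val_one, mul_one, biMatrix_one])
    (fun p => inv_pos.2 (norm_pos_iff.2 (s p.1.1).ne_zero))
    (by rw [hu]; exact hbound k hk)
    (by rw [hinv]; exact hbound k⁻¹ fun i => inv_mem (hk i))
    (fun x => f (g * unip (Composition.ones n) (joinUpper c (y, x))))]
  refine integral_congr_ae (Filter.Eventually.of_forall fun x => ?_)
  change f _ = f _
  rw [mul_assoc]
  congr 2
  refine Units.ext ?_
  rw [leviEmb_mul_unip_val, unip_joinUpper_val]

theorem constantTerm_torusToLevi_mul_unipLevi (t : Fin n → Fˣ)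
    (y : ∀ i, UpperPos (Composition.ones (c.blocksFun i)) → F) :
    constantTerm c f (torusToLevi c t * unipLevi c y) =
      (Real.sqrt (modular c (torusToLevi c t)) : ℂ) *
        ∫ x, f (diagGL t * unip (Composition.ones n) (joinUpper c (y, x)))
          ∂(Measure.pi fun _ => haarF F) := by
  rw [constantTerm, modular_mul, modular_unipLevi, mul_one, map_mul, leviEmb_torusToLevi,
    integral_leviEmb_mul_unip]

theorem integrable_constantTerm (hf : IsHecke f) (t : Fin n → Fˣ) :
    Integrable (fun y => constantTerm c f (torusToLevi c t * unipLevi c y))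
      (unipMeasure F c.blocksFun) := by
  simp_rw [constantTerm_torusToLevi_mul_unipLevi]
  refine Integrable.const_mul ?_ _
  have h := (measurePreserving_joinUpper c).integrable_comp_of_integrable
    (hf.integrable_unip (Composition.ones n) (diagGL t))
  exact h.integral_prod_left

/-- Transitivity of constant terms. -/
theorem integral_constantTerm (hf : IsHecke f) (t : Fin n → Fˣ) :
    ∫ y, constantTerm c f (torusToLevi c t * unipLevi c y) ∂(unipMeasure F c.blocksFun) =
      (Real.sqrt (modular c (torusToLevi c t)) : ℂ) *
        ∫ z, f (diagGL t * unip (Composition.ones n) z) ∂(Measure.pi fun _ => haarF F) := by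
  simp_rw [constantTerm_torusToLevi_mul_unipLevi]
  rw [integral_const_mul]
  have hmp := measurePreserving_joinUpper (F := F) c
  have hint := hf.integrable_unip (Composition.ones n) (diagGL t)
  rw [← hmp.integral_comp (joinUpper (F := F) c).toHomeomorph.measurableEmbedding
    (fun z => f (diagGL t * unip (Composition.ones n) z)),
    integral_prod (fun z => f (diagGL t * unip (Composition.ones n) (joinUpper c z)))
      (hmp.integrable_comp_of_integrable hint)]

theorem satake_eq (f : GL (Fin n) F → ℂ) (t : Fin n → Fˣ) : satake f t =
    (Real.sqrt (modular (Composition.ones n) (torusToLevi (Composition.ones n) t)) : ℂ) *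
      ∫ z, f (diagGL t * unip (Composition.ones n) z) ∂(Measure.pi fun _ => haarF F) := by
  rw [satake, constantTerm, leviEmb_torusToLevi]

end ConstantTerm

/-! ### Laurent polynomials as functions on the torus -/

section LaurentEvaluation

variable {F : Type*} [NontriviallyNormedField F] {n : ℕ} (ϖ : F)

theorem Laurent.toFun_add (p p' : Laurent n) (t : Fin n → Fˣ) :
    (p + p').toFun ϖ t = p.toFun ϖ t + p'.toFun ϖ t := by
  rw [Laurent.toFun, AddMonoidAlgebra.coeff_add, Finsupp.sum_add_index']
  · rfl
  · simp
  · intro μ a b; split_ifs <;> simp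

theorem Laurent.toFun_zero (t : Fin n → Fˣ) : (0 : Laurent n).toFun ϖ t = 0 :=
  Finsupp.sum_zero_index

theorem Laurent.toFun_sum {ι : Type*} (s : Finset ι) (p : ι → Laurent n) (t : Fin n → Fˣ) :
    (∑ i ∈ s, p i).toFun ϖ t = ∑ i ∈ s, (p i).toFun ϖ t := by
  classical
  induction s using Finset.induction_on with
  | empty => exact Laurent.toFun_zero ϖ t
  | insert a s ha ih => rw [Finset.sum_insert ha, Finset.sum_insert ha, Laurent.toFun_add, ih]

theorem Laurent.toFun_smul (z : ℂ) (p : Laurent n) (t : Fin n → Fˣ) :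
    (z • p).toFun ϖ t = z * p.toFun ϖ t := by
  rw [Laurent.toFun, AddMonoidAlgebra.coeff_smul, Finsupp.sum_smul_index (by simp),
    Laurent.toFun, Finsupp.mul_sum]
  simp

open Classical in
theorem Laurent.toFun_single (μ : Fin n → ℤ) (t : Fin n → Fˣ) :
    Laurent.toFun ϖ (AddMonoidAlgebra.single μ 1 : Laurent n) t =
      if ∀ k, ‖(t k : F)‖ = ‖ϖ‖ ^ μ k then 1 else 0 := by
  rw [Laurent.toFun, AddMonoidAlgebra.coeff_single, Finsupp.sum_single_index (by simp)]

theorem prod_X_pow (I : Finset (Fin n)) (α : ℕ) : (∏ i ∈ I, X i) ^ α =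
    (AddMonoidAlgebra.single (fun k => if k ∈ I then (α : ℤ) else 0) 1 : Laurent n) := by
  have h : ∏ i ∈ I, X i =
      (AddMonoidAlgebra.single (∑ i ∈ I, Pi.single i (1 : ℤ)) 1 : Laurent n) := by
    induction I using Finset.induction_on with
    | empty => rfl
    | insert a s ha ih =>
      rw [Finset.prod_insert ha, ih, Finset.sum_insert ha, X, AddMonoidAlgebra.single_mul_single,
        one_mul]
  rw [h, AddMonoidAlgebra.single_pow, one_pow]
  congr 1
  funext k
  simp [Pi.single_apply]

end LaurentEvaluation

/-! ### Values and coefficients of the Kottwitz polynomial -/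

section Kottwitz

variable {F : Type*} [NontriviallyNormedField F] {n : ℕ}

/-- The indices at which the diagonal matrix `t` has valuation `α`. -/
noncomputable def slopeIndices (ϖ : F) (α : ℕ) (t : Fin n → Fˣ) : Finset (Fin n) :=
  Finset.univ.filter fun k => ‖(t k : F)‖ = ‖ϖ‖ ^ α

/-- All valuations of the entries of the diagonal matrix `t` are `0` or `α`. -/
def IsMinuscule (ϖ : F) (α : ℕ) (t : Fin n → Fˣ) : Prop :=
  ∀ k, ‖(t k : F)‖ = 1 ∨ ‖(t k : F)‖ = ‖ϖ‖ ^ α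

theorem IsMinuscule.prod_norm {ϖ : F} {α : ℕ} {t : Fin n → Fˣ} (ht : IsMinuscule ϖ α t) :
    ∏ k, ‖(t k : F)‖ = ‖ϖ‖ ^ (α * (slopeIndices ϖ α t).card) := by
  rw [pow_mul, ← Finset.prod_const, slopeIndices, Finset.prod_filter]
  refine Finset.prod_congr rfl fun k _ => ?_
  split_ifs with h
  · exact h
  · exact (ht k).resolve_right h

variable [IsUltrametricDist F]

/-- Since `α > 0`, the norms `1` and `‖ϖ‖ ^ α` differ, so `t` determines `I`. Hence at most one
monomial of the Kottwitz polynomial is nonzero at `t`. -/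
theorem slopeIndices_eq_iff {ϖ : F} (hϖ : IsNormalizedUniformizer ϖ) {α : ℕ} (hα : 0 < α)
    (t : Fin n → Fˣ) (I : Finset (Fin n)) :
    (∀ k, ‖(t k : F)‖ = ‖ϖ‖ ^ (if k ∈ I then (α : ℤ) else 0)) ↔
      IsMinuscule ϖ α t ∧ slopeIndices ϖ α t = I := by
  have hne : (1 : ℝ) ≠ ‖ϖ‖ ^ α :=
    (pow_lt_one₀ hϖ.norm_pos.le hϖ.norm_lt_one hα.ne').ne'
  constructor
  · intro h
    refine ⟨fun k => ?_, ?_⟩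
    · by_cases hk : k ∈ I
      · exact Or.inr (by simpa [hk] using h k)
      · exact Or.inl (by simpa [hk] using h k)
    · ext k
      by_cases hk : k ∈ I
      · simpa [slopeIndices, hk] using h k
      · have : ‖(t k : F)‖ = 1 := by simpa [hk] using h k
        simpa [slopeIndices, hk, this] using hne
  · rintro ⟨h, rfl⟩ k
    by_cases hk : ‖(t k : F)‖ = ‖ϖ‖ ^ α
    · simp [slopeIndices, hk]
    · simpa [slopeIndices, hk] using (h k).resolve_right hk

/-- The coefficient `q^{α s (n - s) / 2}`. -/
noncomputable def kottwitzCoeff (F : Type*) [NontriviallyNormedField F] [IsUltrametricDist F]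
    (n α s : ℕ) : ℂ :=
  (((resCard F : ℝ) ^ ((α : ℝ) * s * ((n : ℝ) - s) / 2) : ℝ) : ℂ)

open Classical in
theorem toFun_kottwitzPoly {ϖ : F} (hϖ : IsNormalizedUniformizer ϖ) {α : ℕ} (hα : 0 < α) (s : ℕ)
    (t : Fin n → Fˣ) : (kottwitzPoly F n α s).toFun ϖ t =
      if IsMinuscule ϖ α t ∧ (slopeIndices ϖ α t).card = s then kottwitzCoeff F n α s else 0 := by
  rw [kottwitzPoly, Laurent.toFun_smul, Laurent.toFun_sum]
  simp_rw [prod_X_pow, Laurent.toFun_single, slopeIndices_eq_iff hϖ hα]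
  by_cases ht : IsMinuscule ϖ α t
  · simp only [ht, true_and, Finset.sum_ite_eq, Finset.mem_powersetCard, Finset.subset_univ]
    split_ifs <;> simp [kottwitzCoeff]
  · simp [ht]

theorem sum_card_slopeIndices (c : Composition n) (ϖ : F) (α : ℕ) (t : Fin n → Fˣ) :
    ∑ i, (slopeIndices ϖ α fun p => t (c.embedding i p)).card = (slopeIndices ϖ α t).card := by
  simp_rw [slopeIndices, Finset.card_filter]
  rw [← c.blocksFinEquiv.sum_comp, Fintype.sum_sigma]
  rfl

theorem isMinuscule_iff_blocks (c : Composition n) (ϖ : F) (α : ℕ) (t : Fin n → Fˣ) :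
    IsMinuscule ϖ α t ↔ ∀ i, IsMinuscule ϖ α fun p => t (c.embedding i p) := by
  refine ⟨fun h i p => h _, fun h a => ?_⟩
  obtain ⟨i, p, rfl⟩ := exists_eq_embedding c a
  exact h i p

/-- This is the source of `constC`: it is the difference between the exponent for `GL_n` and the sum
of the exponents for the blocks, with `α` factored out. -/
theorem kottwitzCoeff_eq_prod (hq : 0 < resCard F) (c : Composition n) (α s : ℕ)
    (si : Fin c.length → ℕ) : kottwitzCoeff F n α s =
      (((resCard F : ℝ) ^ ((α : ℝ) * constC c s si) : ℝ) : ℂ) *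
        ∏ i, kottwitzCoeff F (c.blocksFun i) α (si i) := by
  have hq' : (0 : ℝ) < resCard F := by exact_mod_cast hq
  simp_rw [kottwitzCoeff]
  rw [← Complex.ofReal_prod, ← Complex.ofReal_mul, ← Real.rpow_sum_of_pos hq',
    ← Real.rpow_add hq', constC, mul_sub (α : ℝ), Finset.mul_sum]
  have h : ∀ i, (α : ℝ) * si i * ((c.blocksFun i : ℝ) - si i) / 2 =
      α * ((si i : ℝ) * ((c.blocksFun i : ℝ) - si i) / 2) := fun i => by ring
  simp_rw [h]
  congr 2
  ring

end Kottwitz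

section KottwitzIntegrals

variable {F : Type*} [NontriviallyNormedField F] [IsUltrametricDist F] [ProperSpace F]
  [MeasurableSpace F] [BorelSpace F] {n : ℕ} {ϖ : F} {α s : ℕ}

open Classical in
theorem IsKottwitzFunction.integral_eq {f : GL (Fin n) F → ℂ}
    (hf : IsKottwitzFunction ϖ n α s f) (hϖ : IsNormalizedUniformizer ϖ) (hα : 0 < α)
    (t : Fin n → Fˣ) :
    (Real.sqrt (modular (Composition.ones n) (torusToLevi (Composition.ones n) t)) : ℂ) *
      ∫ z, f (diagGL t * unip (Composition.ones n) z) ∂(Measure.pi fun _ => haarF F) =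
      if IsMinuscule ϖ α t ∧ (slopeIndices ϖ α t).card = s then kottwitzCoeff F n α s else 0 := by
  rw [← GLTrunc.satake_eq, hf.satake_eq, toFun_kottwitzPoly hϖ hα]

end KottwitzIntegrals

/-! ### Eigenvalue norms and the clopen set of compact elements -/

section Eigenvalues

variable {F : Type*} [NontriviallyNormedField F] {n : ℕ}

theorem charpoly_leviEmb (c : Composition n) (m : Levi F c) :
    (leviEmb c m).val.charpoly = ∏ i, (m i).val.charpoly := by
  have h : (leviEmb c m).val = Matrix.reindex c.blocksFinEquiv c.blocksFinEquiv
      (Matrix.blockDiagonal' fun i => (m i).val) := rfl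
  rw [h, Matrix.charpoly_reindex,
    (Matrix.blockTriangular_blockDiagonal' (fun i => (m i).val)).charpoly]
  -- Blocks of a composition are nonempty, so every block index occurs in the product.
  have himg : Finset.image Sigma.fst
      (Finset.univ : Finset (Σ i, Fin (c.blocksFun i))) = Finset.univ := by
    ext i
    simp only [Finset.mem_image, Finset.mem_univ, true_and, iff_true]
    exact ⟨⟨i, ⟨0, c.one_le_blocksFun i⟩⟩, rfl⟩
  rw [himg]
  refine Finset.prod_congr rfl fun i _ => ?_
  let e : Fin (c.blocksFun i) ≃ {x : Σ i, Fin (c.blocksFun i) // x.1 = i} :=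
    { toFun := fun p => ⟨⟨i, p⟩, rfl⟩
      invFun := fun x => x.2 ▸ x.1.2
      left_inv := fun p => rfl
      right_inv := by rintro ⟨⟨i, p⟩, rfl⟩; rfl }
  rw [← Matrix.charpoly_reindex e (m i).val]
  congr 1
  ext x y
  obtain ⟨p, rfl⟩ := e.surjective x
  obtain ⟨q, rfl⟩ := e.surjective y
  rw [Matrix.reindex_apply, Matrix.submatrix_apply, e.symm_apply_apply, e.symm_apply_apply]
  exact Matrix.blockDiagonal'_apply_eq (fun i => (m i).val) i p q

theorem eigenvalues_leviEmb (c : Composition n) (m : Levi F c) :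
    eigenvalues (leviEmb c m) = ∑ i, eigenvalues (m i) := by
  rw [eigenvalues, charpoly_leviEmb, Polynomial.aroots_def, Polynomial.map_prod,
    Polynomial.roots_prod]
  · rfl
  · exact Finset.prod_ne_zero_iff.2 fun i _ => ((Matrix.charpoly_monic _).map _).ne_zero

theorem card_eigenvalues (g : GL (Fin n) F) : Multiset.card (eigenvalues g) = n := by
  rw [eigenvalues, Polynomial.aroots_def,
    ← (IsAlgClosed.splits (g.val.charpoly.map _)).natDegree_eq_card_roots,
    Polynomial.natDegree_map, Matrix.charpoly_natDegree_eq_dim, Fintype.card_fin]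

theorem prod_eigenvalues (g : GL (Fin n) F) :
    (eigenvalues g).prod = algebraMap F (AlgebraicClosure F) g.val.det := by
  rw [RingHom.map_det, Matrix.det_eq_prod_roots_charpoly, RingHom.mapMatrix_apply,
    Matrix.charpoly_map]
  rfl

variable [IsUltrametricDist F] [CompleteSpace F]

theorem prod_spectralNorm_eigenvalues (g : GL (Fin n) F) :
    ((eigenvalues g).map (spectralNorm F (AlgebraicClosure F))).prod = ‖g.val.det‖ := by
  have h := (map_multiset_prod (spectralMulAlgNorm F (AlgebraicClosure F)) (eigenvalues g)).symm
  rw [prod_eigenvalues] at h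
  exact h.trans (spectralNorm_extends _)

theorem spectralNorm_eigenvalue_pow {g : GL (Fin n) F}
    (hg : ∀ x ∈ eigenvalues g, ∀ y ∈ eigenvalues g,
      spectralNorm F (AlgebraicClosure F) x = spectralNorm F (AlgebraicClosure F) y)
    {x : AlgebraicClosure F} (hx : x ∈ eigenvalues g) :
    spectralNorm F (AlgebraicClosure F) x ^ n = ‖g.val.det‖ := by
  have h : (eigenvalues g).map (spectralNorm F (AlgebraicClosure F)) =
      Multiset.replicate n (spectralNorm F (AlgebraicClosure F) x) := by
    rw [Multiset.eq_replicate, Multiset.card_map, card_eigenvalues]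
    refine ⟨rfl, fun r hr => ?_⟩
    obtain ⟨y, hy, rfl⟩ := Multiset.mem_map.1 hr
    exact hg y hy x hx
  rw [← prod_spectralNorm_eigenvalues, h, Multiset.prod_replicate]

theorem spectralNorm_le_spectralValue {g : GL (Fin n) F} {x : AlgebraicClosure F}
    (hx : x ∈ eigenvalues g) :
    spectralNorm F (AlgebraicClosure F) x ≤ spectralValue g.val.charpoly := by
  refine norm_root_le_spectralValue (f := spectralAlgNorm F (AlgebraicClosure F))
    spectralAlgNorm_isPowMul isNonarchimedean_spectralNorm (Matrix.charpoly_monic _) ?_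
  exact (Polynomial.mem_aroots.1 hx).2

theorem spectralValue_le {g : GL (Fin n) F} {ρ : ℝ} (hρ : 0 ≤ ρ)
    (h : ∀ x ∈ eigenvalues g, spectralNorm F (AlgebraicClosure F) x ≤ ρ) :
    spectralValue g.val.charpoly ≤ ρ := by
  classical
  rw [← max_norm_root_eq_spectralValue (f := spectralAlgNorm F (AlgebraicClosure F))
    spectralAlgNorm_isPowMul isNonarchimedean_spectralNorm spectralAlgNorm_one
    g.val.charpoly (eigenvalues g)]
  · refine ciSup_le fun x => ?_
    split_ifs with hx
    · exact h x hx
    · exact hρ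
  · rw [Polynomial.mapAlg_eq_map]
    exact (IsAlgClosed.splits _).eq_prod_roots_of_monic ((Matrix.charpoly_monic _).map _)

/-- Factors bounded by `ρ` whose product is the largest possible cannot have one below `ρ`. -/
theorem eq_of_prod_map_eq_pow {α : Type*} {s : Multiset α} {φ : α → ℝ} {ρ : ℝ}
    (hφ : ∀ x ∈ s, 0 < φ x) (hle : ∀ x ∈ s, φ x ≤ ρ)
    (hprod : (s.map φ).prod = ρ ^ Multiset.card s) {x : α} (hx : x ∈ s) : φ x = ρ := by
  have hρ : 0 < ρ := (hφ x hx).trans_le (hle x hx)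
  obtain ⟨s, rfl⟩ := Multiset.exists_cons_of_mem hx
  rw [Multiset.map_cons, Multiset.prod_cons, Multiset.card_cons, pow_succ'] at hprod
  have h1 : (s.map φ).prod ≤ ρ ^ Multiset.card s := by
    have := Multiset.prod_map_le_prod_map₀ φ (fun _ => ρ)
      (fun y hy => (hφ y (Multiset.mem_cons_of_mem hy)).le)
      (fun y hy => hle y (Multiset.mem_cons_of_mem hy))
    simpa using this
  refine le_antisymm (hle x hx) ?_
  by_contra! hlt
  have h2 : φ x * (s.map φ).prod ≤ φ x * ρ ^ Multiset.card s :=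
    mul_le_mul_of_nonneg_left h1 (hφ x hx).le
  have h3 : φ x * ρ ^ Multiset.card s < ρ * ρ ^ Multiset.card s :=
    mul_lt_mul_of_pos_right hlt (pow_pos hρ _)
  linarith

theorem norm_det_pos (g : GL (Fin n) F) : 0 < ‖g.val.det‖ :=
  norm_pos_iff.2 ((Matrix.isUnit_iff_isUnit_det _).1 g.isUnit).ne_zero

/-- The Newton polygon of the characteristic polynomial is a single segment. With `ρ = ‖det g‖ ^ (1
/ n)`, the coefficient bounds say that the spectral value, which is the largest eigenvalue norm, is
at most `ρ`; as the product of the norms is `ρ ^ n`, all are then equal to `ρ`. -/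
theorem eigenvalues_eq_norm_iff (hn : n ≠ 0) (g : GL (Fin n) F) :
    (∀ x ∈ eigenvalues g, ∀ y ∈ eigenvalues g,
      spectralNorm F (AlgebraicClosure F) x = spectralNorm F (AlgebraicClosure F) y) ↔
      ∀ k < n, ‖g.val.charpoly.coeff k‖ ^ n ≤ ‖g.val.det‖ ^ (n - k) := by
  set ρ : ℝ := ‖g.val.det‖ ^ ((n : ℝ)⁻¹) with hρ
  have hρ0 : 0 ≤ ρ := Real.rpow_nonneg (norm_nonneg _) _
  have hρn : ρ ^ n = ‖g.val.det‖ := Real.rpow_inv_natCast_pow (norm_nonneg _) hn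
  have hdeg : g.val.charpoly.natDegree = n := by
    rw [Matrix.charpoly_natDegree_eq_dim, Fintype.card_fin]
  have hterm : ∀ k < n, (‖g.val.charpoly.coeff k‖ ^ n ≤ ‖g.val.det‖ ^ (n - k) ↔
      spectralValueTerms g.val.charpoly k ≤ ρ) := by
    intro k hk
    rw [spectralValueTerms_of_lt_natDegree _ (by rwa [hdeg]), hdeg, ← hρn, ← pow_mul, mul_comm,
      pow_mul, pow_le_pow_iff_left₀ (norm_nonneg _) (pow_nonneg hρ0 _) hn, one_div,
      Real.rpow_inv_le_iff_of_pos (norm_nonneg _) hρ0 (by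
        have : (k : ℝ) < n := by exact_mod_cast hk
        linarith), ← Nat.cast_sub hk.le, Real.rpow_natCast]
  constructor
  · intro h k hk
    rw [hterm k hk]
    refine (le_ciSup (spectralValueTerms_bddAbove _) k).trans (spectralValue_le hρ0 fun x hx => ?_)
    refine le_of_eq ((pow_left_inj₀ (spectralNorm_nonneg _) hρ0 hn).1 ?_)
    rw [spectralNorm_eigenvalue_pow h hx, hρn]
  · intro h
    have hle : spectralValue g.val.charpoly ≤ ρ := by
      refine ciSup_le fun k => ?_
      rcases lt_or_ge k n with hk | hk
      · exact (hterm k hk).1 (h k hk)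
      · rw [spectralValueTerms_of_natDegree_le _ (by rwa [hdeg])]
        exact hρ0
    have hpos : ∀ x ∈ eigenvalues g, 0 < spectralNorm F (AlgebraicClosure F) x := by
      intro x hx
      refine lt_of_le_of_ne (spectralNorm_nonneg _) fun h0 => ?_
      have h1 : ((eigenvalues g).map (spectralNorm F (AlgebraicClosure F))).prod = 0 :=
        Multiset.prod_eq_zero (Multiset.mem_map.2 ⟨x, hx, h0.symm⟩)
      rw [prod_spectralNorm_eigenvalues] at h1
      exact (norm_det_pos g).ne' h1
    have heq : ∀ x ∈ eigenvalues g, spectralNorm F (AlgebraicClosure F) x = ρ := fun x hx =>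
      eq_of_prod_map_eq_pow hpos (fun x hx => (spectralNorm_le_spectralValue hx).trans hle)
        (by rw [prod_spectralNorm_eigenvalues, card_eigenvalues, hρn]) hx
    exact fun x hx y hy => (heq x hx).trans (heq y hy).symm

theorem continuous_charpoly_coeff (k : ℕ) :
    Continuous fun g : GL (Fin n) F => g.val.charpoly.coeff k := by
  have h : (fun g : GL (Fin n) F => g.val.charpoly.coeff k) = fun g =>
      MvPolynomial.eval (fun p : Fin n × Fin n => g.val p.1 p.2)
        ((Matrix.charpoly.univ F (Fin n)).coeff k) := by
    funext g
    exact (Matrix.charpoly.univ_coeff_eval₂Hom (Fin n) (RingHom.id F)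
      (fun p : Fin n × Fin n => g.val p.1 p.2) k).symm
  rw [h]
  exact (MvPolynomial.continuous_eval _).comp
    (continuous_pi fun p => continuous_GL_apply p.1 p.2)

theorem isClopen_setOf_norm_le {Y : Type*} [TopologicalSpace Y] {φ ψ : Y → F}
    (hφ : Continuous φ) (hψ : Continuous ψ) (h0 : ∀ y, ψ y ≠ 0) :
    IsClopen {y | ‖φ y‖ ≤ ‖ψ y‖} := by
  have h : {y | ‖φ y‖ ≤ ‖ψ y‖} = (fun y => φ y / ψ y) ⁻¹' Metric.closedBall 0 1 := by
    ext y
    simp [div_le_one₀ (norm_pos_iff.2 (h0 y))]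
  rw [h]
  exact (IsUltrametricDist.isClopen_closedBall 0 one_ne_zero).preimage (hφ.div₀ hψ h0)

/-- The coefficient criterion is a finite system of inequalities `‖φ‖ ≤ ‖ψ‖` with `φ`, `ψ`
continuous and `ψ` nowhere zero, and closed balls in `F` are open. -/
theorem isClopen_compactElements (c : Composition n) : IsClopen (compactElements F c) := by
  have h : compactElements F c = ⋂ i, ⋂ k : Fin (c.blocksFun i),
      {m : Levi F c | ‖(m i).val.charpoly.coeff k ^ (c.blocksFun i)‖ ≤
        ‖(m i).val.det ^ (c.blocksFun i - k)‖} := by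
    ext m
    simp only [compactElements, Set.mem_ofPred_eq, Set.mem_iInter, norm_pow]
    refine forall_congr' fun i => ?_
    rw [eigenvalues_eq_norm_iff (Nat.one_le_iff_ne_zero.1 (c.one_le_blocksFun i))]
    exact ⟨fun h k => h k k.2, fun h k hk => h ⟨k, hk⟩⟩
  rw [h]
  refine isClopen_iInter_of_finite fun i => isClopen_iInter_of_finite fun k =>
    isClopen_setOf_norm_le ?_ ?_ fun m => ?_
  · exact ((continuous_charpoly_coeff _).comp (continuous_apply i)).pow _
  · exact ((Units.continuous_val.comp (continuous_apply i)).matrix_det).pow _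
  · exact pow_ne_zero _ (norm_pos_iff.1 (norm_det_pos (m i)))

end Eigenvalues

/-! ### Slopes of compact elements, and compositions recovered from them -/

section Slopes

variable {F : Type*} [NontriviallyNormedField F] [IsUltrametricDist F] {n : ℕ}

/-- The normalised valuations of the determinants of the blocks. -/
noncomputable def blockSlope (c : Composition n) (m : Levi F c) (i : Fin c.length) : ℝ :=
  val (m i).val.det / c.blocksFun i

theorem mem_positiveChamber_iff (c : Composition n) (m : Levi F c) :
    m ∈ positiveChamber F c ↔ StrictAnti (blockSlope c m) :=
  ⟨fun h _ _ => h _ _, fun h _ _ hij => h hij⟩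

theorem map_valBar_eigenvalues [CompleteSpace F] (c : Composition n) {m : Levi F c}
    (hm : m ∈ compactElements F c) (i : Fin c.length) :
    (eigenvalues (m i)).map valBar =
      Multiset.replicate (c.blocksFun i) (blockSlope c m i) := by
  rw [Multiset.eq_replicate, Multiset.card_map, card_eigenvalues]
  refine ⟨rfl, fun r hr => ?_⟩
  obtain ⟨x, hx, rfl⟩ := Multiset.mem_map.1 hr
  have hn : (c.blocksFun i : ℝ) ≠ 0 := by
    exact_mod_cast Nat.one_le_iff_ne_zero.1 (c.one_le_blocksFun i)
  rw [blockSlope, val, valBar, ← spectralNorm_eigenvalue_pow (hm i) hx, Real.logb_pow,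
    eq_div_iff hn]
  ring

theorem index_monotone (c : Composition n) : Monotone c.index := by
  intro a b hab
  by_contra! h
  exact absurd (lt_of_index_lt c h) hab.not_gt

/-- Block `i` contributes its slope repeated as many times as its size. In the positive chamber the
blocks are already in decreasing order of slope, so sorting changes nothing. -/
theorem slopes_leviEmb [CompleteSpace F] (c : Composition n) {m : Levi F c}
    (hm : m ∈ compactElements F c) (hpos : m ∈ positiveChamber F c) :
    slopes (leviEmb c m) = List.ofFn fun a => blockSlope c m (c.index a) := by
  have h : (eigenvalues (leviEmb c m)).map valBar =
      (List.ofFn fun a => blockSlope c m (c.index a) : Multiset ℝ) := by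
    rw [eigenvalues_leviEmb, ← Multiset.coe_mapAddMonoidHom, map_sum]
    simp_rw [Multiset.coe_mapAddMonoidHom, map_valBar_eigenvalues c hm,
      ← Multiset.nsmul_singleton]
    have h1 : (List.ofFn fun a => blockSlope c m (c.index a) : Multiset ℝ) =
        ∑ a, {blockSlope c m (c.index a)} := by
      rw [List.ofFn_eq_map, ← Multiset.map_coe, ← Multiset.sum_map_singleton (Multiset.map _ _),
        Multiset.map_map]
      rfl
    rw [h1, ← c.blocksFinEquiv.sum_comp, Fintype.sum_sigma]
    refine Finset.sum_congr rfl fun i _ => ?_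
    have h2 : ∀ p : Fin (c.blocksFun i), c.index (c.blocksFinEquiv ⟨i, p⟩) = i :=
      fun p => c.index_embedding i p
    simp [h2]
  rw [slopes, h, Multiset.coe_sort]
  refine List.mergeSort_eq_self _ (List.pairwise_ofFn.2 fun a b hab => ?_)
  exact ((mem_positiveChamber_iff c m).1 hpos).antitone (index_monotone c hab.le)

theorem mem_boundaries_iff (c : Composition n) (j : Fin n) :
    j.castSucc ∈ c.boundaries ↔ (j : ℕ) = 0 ∨
      ∃ k : Fin n, (k : ℕ) + 1 = j ∧ c.index k < c.index j := by
  have hmem : j.castSucc ∈ c.boundaries ↔ ∃ i : Fin (c.length + 1), c.sizeUpTo i = j := by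
    simp [Composition.boundaries, Composition.boundary, Fin.ext_iff]
  have hlt := c.lt_sizeUpTo_index_succ j
  rw [hmem]
  constructor
  · rintro ⟨i, hi⟩
    refine or_iff_not_imp_left.2 fun hj => ⟨⟨j - 1, by omega⟩, by simp; omega, ?_⟩
    by_contra! hle
    have h1 : (i : ℕ) < (c.index j).succ := by
      by_contra! h
      have := c.monotone_sizeUpTo h
      omega
    have h2 : c.sizeUpTo i ≤ c.sizeUpTo (c.index ⟨j - 1, by omega⟩) := by
      refine c.monotone_sizeUpTo ?_
      have : (c.index j : ℕ) ≤ c.index ⟨j - 1, by omega⟩ := hle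
      simp only [Fin.val_succ] at h1
      omega
    have h3 : c.sizeUpTo (c.index ⟨j - 1, by omega⟩) ≤ j - 1 :=
      c.sizeUpTo_index_le ⟨j - 1, by omega⟩
    omega
  · rintro (h0 | ⟨k, hk, hlt'⟩)
    · exact ⟨0, by simp [h0]⟩
    · refine ⟨(c.index k).succ, le_antisymm ?_ ?_⟩
      · exact (c.monotone_sizeUpTo (show ((c.index k).succ : ℕ) ≤ c.index j from hlt')).trans
          (c.sizeUpTo_index_le j)
      · have := c.lt_sizeUpTo_index_succ k
        omega

/-- A composition is determined by its boundaries: the endpoints `0` and `n`, and the positions at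
which the block index jumps. -/
theorem eq_of_index_lt_iff {c d : Composition n}
    (h : ∀ a b, d.index a < d.index b ↔ c.index a < c.index b) : d = c := by
  refine (compositionEquiv n).injective (CompositionAsSet.ext ?_)
  change d.boundaries = c.boundaries
  ext j
  refine Fin.lastCases ?_ (fun j => ?_) j
  · exact iff_of_true d.toCompositionAsSet.getLast_mem c.toCompositionAsSet.getLast_mem
  · simp_rw [mem_boundaries_iff, h]

end Slopes

/-! ### Bounded supports and determinants -/

section BoundedSupport

variable {F : Type*} [NontriviallyNormedField F] [IsUltrametricDist F] {l : ℕ} {m : Fin l → ℕ}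

theorem HasBoundedSupport.of_or {h h₁ h₂ : (∀ i, GL (Fin (m i)) F) → ℂ}
    (hb₁ : HasBoundedSupport h₁) (hb₂ : HasBoundedSupport h₂)
    (hor : ∀ g, h g ≠ 0 → h₁ g ≠ 0 ∨ h₂ g ≠ 0) : HasBoundedSupport h := by
  obtain ⟨C₁, hC₁⟩ := hb₁
  obtain ⟨C₂, hC₂⟩ := hb₂
  refine ⟨max C₁ C₂, fun g hg i a b => ?_⟩
  rcases hor g hg with hg | hg
  · exact ⟨(hC₁ g hg i a b).1.trans (le_max_left _ _), (hC₁ g hg i a b).2.trans (le_max_left _ _)⟩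
  · exact ⟨(hC₂ g hg i a b).1.trans (le_max_right _ _),
      (hC₂ g hg i a b).2.trans (le_max_right _ _)⟩

theorem hasBoundedSupport_prod {φ : ∀ i, GL (Fin (m i)) F → ℂ} (hφ : ∀ i, IsHecke (φ i)) :
    HasBoundedSupport fun g : ∀ i, GL (Fin (m i)) F => ∏ i, φ i (g i) := by
  choose C hC using fun i => (hφ i).exists_bound
  refine ⟨∑ i, |C i|, fun g hg i a b => ?_⟩
  have h1 := hC i (g i) (Finset.prod_ne_zero_iff.1 hg i (Finset.mem_univ i)) a b
  have h2 : C i ≤ ∑ i, |C i| := (le_abs_self _).trans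
    (Finset.single_le_sum (f := fun i => |C i|) (fun i _ => abs_nonneg _) (Finset.mem_univ i))
  exact ⟨h1.1.trans h2, h1.2.trans h2⟩

end BoundedSupport

section DetRegions

variable {F : Type*} [NontriviallyNormedField F] [IsUltrametricDist F] {n : ℕ}

theorem norm_det_mul_maxCompact {k₁ k₂ : GL (Fin n) F} (h₁ : k₁ ∈ maxCompact F n)
    (h₂ : k₂ ∈ maxCompact F n) (g : GL (Fin n) F) :
    ‖(k₁ * g * k₂).val.det‖ = ‖g.val.det‖ := by
  rw [Units.val_mul, Units.val_mul, Matrix.det_mul, Matrix.det_mul, norm_mul, norm_mul,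
    (mem_maxCompact_iff.1 h₁).2, (mem_maxCompact_iff.1 h₂).2, one_mul, mul_one]

theorem norm_det_diagGL_mul_unip (t : Fin n → Fˣ) (c : Composition n) (x : UpperPos c → F) :
    ‖(diagGL t * unip c x).val.det‖ = ∏ k, ‖(t k : F)‖ := by
  rw [Units.val_mul, Matrix.det_mul, show (unip c x).val.det = 1 from det_unipMatrix c x, mul_one,
    diagGL_val, Matrix.det_diagonal, norm_prod]

end DetRegions

/-! ### Constant terms of Kottwitz functions -/

section Kottwitz

variable {F : Type*} [NontriviallyNormedField F] [IsUltrametricDist F] [ProperSpace F]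
  [MeasurableSpace F] [BorelSpace F] {n : ℕ} {ϖ : F} {α s : ℕ} {f : GL (Fin n) F → ℂ}

/-- The normalising factor of the Satake transform on the Levi subgroup. -/
noncomputable def sqrtModularLevi (c : Composition n) (t : Fin n → Fˣ) : ℂ :=
  ∏ i, (Real.sqrt (modular (Composition.ones (c.blocksFun i))
    (torusToLevi (Composition.ones (c.blocksFun i)) fun p => t (c.embedding i p))) : ℂ)

theorem sqrtModularLevi_ne_zero (c : Composition n) (t : Fin n → Fˣ) :
    sqrtModularLevi c t ≠ 0 :=
  Finset.prod_ne_zero_iff.2 fun _ _ =>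
    Complex.ofReal_ne_zero.2 (Real.sqrt_pos.2 (modular_pos _ _)).ne'

open Classical in
-- Transitivity of constant terms, with the modulus of the Borel subgroup split into the moduli for
-- the blocks and for `N`: the Satake transform of the constant term on `M` is that of `f`.
theorem IsKottwitzFunction.integral_constantTerm (hf : IsKottwitzFunction ϖ n α s f)
    (hϖ : IsNormalizedUniformizer ϖ) (hα : 0 < α) (c : Composition n) (t : Fin n → Fˣ) :
    sqrtModularLevi c t * ∫ y, constantTerm c f (torusToLevi c t * unipLevi c y)
      ∂(unipMeasure F c.blocksFun) =
      if IsMinuscule ϖ α t ∧ (slopeIndices ϖ α t).card = s then kottwitzCoeff F n α s else 0 := by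
  rw [← hf.integral_eq hϖ hα t, GLTrunc.integral_constantTerm c hf.unramified.toIsHecke t,
    modular_ones_torusToLevi c, Real.sqrt_mul (Finset.prod_nonneg fun i _ => (modular_pos _ _).le),
    Real.sqrt_prod _ (fun i _ => (modular_pos _ _).le), sqrtModularLevi, ← mul_assoc]
  push_cast
  rfl

open Classical in
theorem integral_prod_kottwitz (hϖ : IsNormalizedUniformizer ϖ) (hα : 0 < α) (c : Composition n)
    {si : Fin c.length → ℕ} {fi : ∀ i : Fin c.length, GL (Fin (c.blocksFun i)) F → ℂ}
    (hfi : ∀ i, IsKottwitzFunction ϖ (c.blocksFun i) α (si i) (fi i)) (t : Fin n → Fˣ) :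
    sqrtModularLevi c t * ∫ y, ∏ i, fi i ((torusToLevi c t * unipLevi c y) i)
      ∂(unipMeasure F c.blocksFun) =
      if ∀ i, IsMinuscule ϖ α (fun p => t (c.embedding i p)) ∧
          (slopeIndices ϖ α fun p => t (c.embedding i p)).card = si i
        then ∏ i, kottwitzCoeff F (c.blocksFun i) α (si i) else 0 := by
  have h := integral_fintype_prod_eq_prod (𝕜 := ℂ)
    (fun (i : Fin c.length) (y : UpperPos (Composition.ones (c.blocksFun i)) → F) =>
      fi i (torusToLevi c t i * unip (Composition.ones (c.blocksFun i)) y))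
    (μ := fun i => Measure.pi fun _ => haarF F)
  refine (congrArg (sqrtModularLevi c t * ·) h).trans ?_
  rw [sqrtModularLevi, ← Finset.prod_mul_distrib]
  simp_rw [torusToLevi_apply c t, fun i => (hfi i).integral_eq hϖ hα]
  split_ifs with hall
  · exact Finset.prod_congr rfl fun i _ => if_pos (hall i)
  · push Not at hall
    obtain ⟨i, hi⟩ := hall
    exact Finset.prod_eq_zero (Finset.mem_univ i) (if_neg fun h => hi h.1 h.2)

theorem integrable_prod_kottwitz (c : Composition n)
    {fi : ∀ i : Fin c.length, GL (Fin (c.blocksFun i)) F → ℂ} (hfi : ∀ i, IsHecke (fi i))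
    (t : Fin n → Fˣ) : Integrable (fun y => ∏ i, fi i ((torusToLevi c t * unipLevi c y) i))
      (unipMeasure F c.blocksFun) :=
  Integrable.fintype_prod_dep fun i => (hfi i).integrable_unip _ (torusToLevi c t i)

theorem exists_torusToLevi_mul_unipLevi (c : Composition n)
    (t : ∀ i, Fin (c.blocksFun i) → Fˣ) : ∃ u : Fin n → Fˣ, ∀ y, (fun i => diagGL (t i) *
      unip (Composition.ones (c.blocksFun i)) (y i)) = torusToLevi c u * unipLevi c y := by
  obtain ⟨u, hu, -⟩ := exists_torusToLevi_eq c t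
  exact ⟨u, fun y => by rw [hu]; rfl⟩

theorem norm_det_torusToLevi_mul_unipLevi (c : Composition n) (t : Fin n → Fˣ)
    (y : ∀ i, UpperPos (Composition.ones (c.blocksFun i)) → F) (i : Fin c.length) :
    ‖((torusToLevi c t * unipLevi c y) i).val.det‖ = ∏ p, ‖(t (c.embedding i p) : F)‖ :=
  norm_det_diagGL_mul_unip _ _ _

theorem pow_mul_injective (hϖ : IsNormalizedUniformizer ϖ) (hα : 0 < α) {k l : ℕ}
    (h : ‖ϖ‖ ^ (α * k) = ‖ϖ‖ ^ (α * l)) : k = l :=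
  Nat.eq_of_mul_eq_mul_left hα
    (pow_right_injective₀ hϖ.norm_pos hϖ.norm_lt_one.ne h)

/-- The constant term of a Kottwitz function is supported on the elements with determinant of
valuation `α s`. -/
theorem IsKottwitzFunction.norm_det_of_constantTerm_ne_zero (hf : IsKottwitzFunction ϖ n α s f)
    (hϖ : IsNormalizedUniformizer ϖ) (hα : 0 < α) (c : Composition n) {m : Levi F c}
    (hm : constantTerm c f m ≠ 0) : ∏ i, ‖(m i).val.det‖ = ‖ϖ‖ ^ (α * s) := by
  classical
  -- The part of the constant term off the expected determinant set. Determinant norms on `t u`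
  -- depend only on `t`, so its Satake integrals are `0` or those of the full constant term at a `t`
  -- where the Kottwitz polynomial vanishes.
  let h : Levi F c → ℂ := fun m =>
    if ∏ i, ‖(m i).val.det‖ = ‖ϖ‖ ^ (α * s) then 0 else constantTerm c f m
  have hzero : h m = 0 := by
    refine eq_zero_of_integral_eq_zero hϖ (fun k₁ k₂ g h₁ h₂ => ?_) ?_ (fun t => ?_) m
    · have hdet : ∀ i, ‖((k₁ * g * k₂) i).val.det‖ = ‖(g i).val.det‖ :=
        fun i => norm_det_mul_maxCompact (h₁ i) (h₂ i) (g i)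
      have hct := constantTerm_bi_invariant c hf.unramified k₁ k₂ g h₁ h₂
      change (if ∏ i, ‖((k₁ * g * k₂) i).val.det‖ = _ then (0 : ℂ) else _) = _
      simp_rw [hdet]
      exact if_congr Iff.rfl rfl hct
    · have hb := hasBoundedSupport_constantTerm c hf.unramified.toIsHecke
      refine hb.of_or hb fun g hg => Or.inl fun h0 => hg ?_
      change (if _ then (0 : ℂ) else constantTerm c f g) = 0
      rw [h0, ite_self]
    · obtain ⟨u, hu⟩ := exists_torusToLevi_mul_unipLevi c t
      simp_rw [hu, h, norm_det_torusToLevi_mul_unipLevi]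
      have hprod : ∏ i, ∏ p, ‖(u (c.embedding i p) : F)‖ = ∏ a, ‖(u a : F)‖ :=
        Composition.prod_prod_apply_embedding (fun a => ‖(u a : F)‖) c
      rw [hprod]
      split_ifs with hR
      · exact integral_zero _ _
      · have h1 := hf.integral_constantTerm hϖ hα c u
        rw [if_neg] at h1
        · exact (mul_eq_zero.1 h1).resolve_left (sqrtModularLevi_ne_zero c u)
        · rintro ⟨hmin, hcard⟩
          rw [hmin.prod_norm, hcard] at hR
          exact hR rfl
  by_contra hne
  exact hm ((if_neg hne).symm.trans hzero)

open Classical in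
/-- The restriction of the constant term of a Kottwitz function to the elements with prescribed
determinant valuations is a tensor product of Kottwitz functions. -/
theorem IsKottwitzFunction.constantTerm_eq (hf : IsKottwitzFunction ϖ n α s f)
    (hϖ : IsNormalizedUniformizer ϖ) (hα : 0 < α) (c : Composition n)
    {si : Fin c.length → ℕ} (hsi : ∑ i, si i = s)
    {fi : ∀ i : Fin c.length, GL (Fin (c.blocksFun i)) F → ℂ}
    (hfi : ∀ i, IsKottwitzFunction ϖ (c.blocksFun i) α (si i) (fi i)) (m : Levi F c) :
    (if ∀ i, ‖(m i).val.det‖ = ‖ϖ‖ ^ (α * si i) then constantTerm c f m else 0) =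
      (((resCard F : ℝ) ^ ((α : ℝ) * constC c s si) : ℝ) : ℂ) * ∏ i, fi i (m i) := by
  set K : ℂ := (((resCard F : ℝ) ^ ((α : ℝ) * constC c s si) : ℝ) : ℂ) with hK
  let h : Levi F c → ℂ := fun m =>
    (if ∀ i, ‖(m i).val.det‖ = ‖ϖ‖ ^ (α * si i) then constantTerm c f m else 0) -
      K * ∏ i, fi i (m i)
  refine sub_eq_zero.1 (?_ : h m = 0)
  refine eq_zero_of_integral_eq_zero hϖ (fun k₁ k₂ g h₁ h₂ => ?_) ?_ (fun t => ?_) m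
  · have hdet : ∀ i, ‖((k₁ * g * k₂) i).val.det‖ = ‖(g i).val.det‖ :=
      fun i => norm_det_mul_maxCompact (h₁ i) (h₂ i) (g i)
    have hct := constantTerm_bi_invariant c hf.unramified k₁ k₂ g h₁ h₂
    have hfi' : ∀ i, fi i ((k₁ * g * k₂) i) = fi i (g i) :=
      fun i => (hfi i).unramified.biInvariant _ (h₁ i) _ (h₂ i) _
    change (if ∀ i, ‖((k₁ * g * k₂) i).val.det‖ = _ then constantTerm c f (k₁ * g * k₂) else 0) -
      K * ∏ i, fi i ((k₁ * g * k₂) i) = _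
    simp_rw [hdet, hfi', hct]
    rfl
  · refine (hasBoundedSupport_constantTerm c hf.unramified.toIsHecke).of_or
      (hasBoundedSupport_prod fun i => (hfi i).unramified.toIsHecke) fun g hg => ?_
    by_contra! h0
    refine hg ?_
    change (if _ then constantTerm c f g else 0) - K * ∏ i, fi i (g i) = 0
    rw [h0.1, show ∏ i, fi i (g i) = 0 from h0.2, ite_self, mul_zero, sub_zero]
  · obtain ⟨u, hu⟩ := exists_torusToLevi_mul_unipLevi c t
    simp_rw [hu, h, norm_det_torusToLevi_mul_unipLevi]
    have hI1 := hf.integral_constantTerm hϖ hα c u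
    have hI2 := integral_prod_kottwitz hϖ hα c hfi u
    have hint := (integrable_prod_kottwitz c (fun i => (hfi i).unramified.toIsHecke) u).const_mul K
    -- If each block has the required entries, both sides contribute, and the coefficients match by
    -- `kottwitzCoeff_eq_prod`. Otherwise the product contributes `0`, and the other side must be
    -- shown to vanish.
    by_cases hall : ∀ i, IsMinuscule ϖ α (fun p => u (c.embedding i p)) ∧
        (slopeIndices ϖ α fun p => u (c.embedding i p)).card = si i
    · have hR : ∀ i, ∏ p, ‖(u (c.embedding i p) : F)‖ = ‖ϖ‖ ^ (α * si i) := fun i => by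
        rw [(hall i).1.prod_norm, (hall i).2]
      have hcond : IsMinuscule ϖ α u ∧ (slopeIndices ϖ α u).card = s := by
        refine ⟨(isMinuscule_iff_blocks c ϖ α u).2 fun i => (hall i).1, ?_⟩
        rw [← sum_card_slopeIndices c, ← hsi]
        exact Finset.sum_congr rfl fun i _ => (hall i).2
      rw [if_pos hcond] at hI1
      rw [if_pos hall] at hI2
      simp_rw [if_pos hR]
      rw [integral_sub (integrable_constantTerm c hf.unramified.toIsHecke u) hint,
        integral_const_mul, sub_eq_zero]
      refine mul_left_cancel₀ (sqrtModularLevi_ne_zero c u) ?_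
      rw [hI1, mul_left_comm, hI2, kottwitzCoeff_eq_prod
        (zero_lt_one.trans hϖ.one_lt_resCard) c α s si]
    · rw [if_neg hall] at hI2
      have hz2 := (mul_eq_zero.1 hI2).resolve_left (sqrtModularLevi_ne_zero c u)
      by_cases hR : ∀ i, ∏ p, ‖(u (c.embedding i p) : F)‖ = ‖ϖ‖ ^ (α * si i)
      · rw [if_neg] at hI1
        · have hz1 := (mul_eq_zero.1 hI1).resolve_left (sqrtModularLevi_ne_zero c u)
          simp_rw [if_pos hR]
          rw [integral_sub (integrable_constantTerm c hf.unramified.toIsHecke u) hint,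
            integral_const_mul, hz1, hz2, mul_zero, sub_zero]
        -- For entries of valuation `0` or `α`, the determinant norm of a block gives the number of
        -- entries of valuation `α`; so if the determinants are right, minuscule `t` would fall into
        -- the previous case.
        · rintro ⟨hmin, -⟩
          refine hall fun i => ⟨(isMinuscule_iff_blocks c ϖ α u).1 hmin i, ?_⟩
          refine pow_mul_injective hϖ hα ?_
          rw [← hR i, ((isMinuscule_iff_blocks c ϖ α u).1 hmin i).prod_norm]
      · simp_rw [if_neg hR, zero_sub]
        rw [integral_neg, integral_const_mul, hz2, mul_zero, neg_zero]

theorem val_eq_natCast_iff (hϖ : IsNormalizedUniformizer ϖ) {x : F} (hx : x ≠ 0) (k : ℕ) :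
    val x = k ↔ ‖x‖ = ‖ϖ‖ ^ k := by
  have hq : (1 : ℝ) < resCard F := by exact_mod_cast hϖ.one_lt_resCard
  have hq0 : (0 : ℝ) < resCard F := zero_lt_one.trans hq
  rw [val, neg_eq_iff_eq_neg, Real.logb_eq_iff_rpow_eq hq0 hq.ne' (norm_pos_iff.2 hx),
    Real.rpow_neg hq0.le, Real.rpow_natCast, hϖ.norm_eq, inv_pow, eq_comm]

end Kottwitz

/-! ### Truncated constant terms -/

section Truncation

variable {F : Type*} [NontriviallyNormedField F] [IsUltrametricDist F] [ProperSpace F]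
  [MeasurableSpace F] [BorelSpace F] {n : ℕ} {f : GL (Fin n) F → ℂ}

theorem exists_blockSlope_eq_of_truncation_ne_zero (c d : Composition n)
    (lam : Fin c.length → ℝ) {m : Levi F d} (hm : truncation d (repeatVec c lam) f m ≠ 0) :
    m ∈ compactElements F d ∧ StrictAnti (blockSlope d m) ∧ constantTerm d f m ≠ 0 ∧
      ∃ t : ℝ, 0 < t ∧ ∀ a, blockSlope d m (d.index a) = t * lam (c.index a) := by
  rw [truncation, mul_ne_zero_iff, mul_ne_zero_iff, mul_ne_zero_iff] at hm
  obtain ⟨⟨⟨h1, h2⟩, h3⟩, h4⟩ := hm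
  have hc : m ∈ compactElements F d := Set.mem_of_indicator_ne_zero h1
  have hs : leviEmb d m ∈ slopeSet F (repeatVec c lam) := Set.mem_of_indicator_ne_zero h2
  have hp : m ∈ positiveChamber F d := Set.mem_of_indicator_ne_zero h3
  obtain ⟨t, ht, hslope⟩ := hs
  rw [slopes_leviEmb d hc hp] at hslope
  exact ⟨hc, (mem_positiveChamber_iff d m).1 hp, h4, t, ht,
    fun a => congrFun (List.ofFn_injective hslope) a⟩

/-- At a point of the support, the slopes of `d` and the numbers `tλ_i` of `c` give the same
function on `Fin n`. Both strictly decrease from block to block, so the two compositions separate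
the same pairs of indices. -/
theorem truncation_eq_zero_of_ne {c d : Composition n} (hdc : d ≠ c) {lam : Fin c.length → ℝ}
    (hlam : StrictAnti lam) : truncation d (repeatVec c lam) f = fun _ => 0 := by
  funext m
  by_contra hm
  obtain ⟨-, hanti, -, t, ht, heq⟩ := exists_blockSlope_eq_of_truncation_ne_zero c d lam hm
  refine hdc (eq_of_index_lt_iff fun a b => ?_)
  rw [← hanti.lt_iff_gt, heq, heq, mul_lt_mul_iff_right₀ ht, hlam.lt_iff_gt]

/-- All three characteristic functions equal `1` here: the chamber condition follows from the strict
decrease of `λ`, and then the slope list is `tλ`. -/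
theorem truncation_of_mem {c : Composition n} {lam : Fin c.length → ℝ} (hlam : StrictAnti lam)
    {t : ℝ} (ht : 0 < t) {m : Levi F c} (hm : m ∈ compactElements F c)
    (hslope : ∀ i, blockSlope c m i = t * lam i) :
    truncation c (repeatVec c lam) f m = constantTerm c f m := by
  have hp : m ∈ positiveChamber F c := by
    rw [mem_positiveChamber_iff]
    intro i j hij
    rw [hslope, hslope]
    exact mul_lt_mul_of_pos_left (hlam hij) ht
  have hs : leviEmb c m ∈ slopeSet F (repeatVec c lam) := by
    refine ⟨t, ht, ?_⟩
    rw [slopes_leviEmb c hm hp]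
    simp_rw [hslope]
    rfl
  rw [truncation, charCompact, charSlope, charPositive, Set.indicator_of_mem hm,
    Set.indicator_of_mem hs, Set.indicator_of_mem hp]
  simp

theorem isHecke_charCompact_mul_prod (c : Composition n) (z : ℂ)
    {fi : ∀ i : Fin c.length, GL (Fin (c.blocksFun i)) F → ℂ} (hfi : ∀ i, IsHecke (fi i)) :
    IsHecke fun m : Levi F c => z * (charCompact c m * ∏ i, fi i (m i)) := by
  have hprod : IsLocallyConstant fun m : Levi F c => ∏ i, fi i (m i) := by
    have : (fun m : Levi F c => ∏ i, fi i (m i)) =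
        (fun v : Fin c.length → ℂ => ∏ i, v i) ∘ fun m i => fi i (m i) := rfl
    rw [this, IsLocallyConstant.iff_eventually_eq]
    intro m
    have h : ∀ i, ∀ᶠ m' in nhds m, fi i (m' i) = fi i (m i) := fun i =>
      (((hfi i).locConst.comp_continuous (continuous_apply i)).eventually_eq m)
    filter_upwards [Filter.eventually_all.2 h] with m' hm'
    simp [hm']
  have hchar : IsLocallyConstant (charCompact (F := F) c) := by
    rw [IsLocallyConstant.iff_eventually_eq]
    intro m
    by_cases hm : m ∈ compactElements F c
    · filter_upwards [(isClopen_compactElements c).isOpen.mem_nhds hm] with m' hm'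
      rw [charCompact, Set.indicator_of_mem hm, Set.indicator_of_mem hm']
      rfl
    · filter_upwards [(isClopen_compactElements c).compl.isOpen.mem_nhds hm] with m' hm'
      rw [charCompact, Set.indicator_of_notMem hm, Set.indicator_of_notMem hm']
  refine ⟨(IsLocallyConstant.const z).mul (hchar.mul hprod), ?_⟩
  refine HasCompactSupport.intro (K := Set.univ.pi fun i => tsupport (fi i))
    (isCompact_univ_pi fun i => (hfi i).compactSupport.isCompact) fun m hm => ?_
  obtain ⟨i, hi⟩ : ∃ i, m i ∉ tsupport (fi i) := by simpa using hm
  rw [Finset.prod_eq_zero (Finset.mem_univ i) (image_eq_zero_of_notMem_tsupport (f := fi i) hi),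
    mul_zero, mul_zero]

end Truncation

end GLTrunc

/-! ### The proposition -/

theorem proposition3p3 {F : Type*} [NontriviallyNormedField F] [IsUltrametricDist F]
    [ProperSpace F] [CharZero F] [MeasurableSpace F] [BorelSpace F]
    (ϖ : F) (hϖ : GLTrunc.IsNormalizedUniformizer ϖ)
    (n α s : ℕ) (hα : 0 < α) (hs : 0 < s) (hsn : s ≤ n)
    (c : Composition n) (lam : Fin c.length → ℝ) (si : Fin c.length → ℕ)
    (hlam_int : ∀ i, lam i * (c.blocksFun i : ℝ) = (si i : ℝ))
    (hlam_sum : ∑ i, lam i * (c.blocksFun i : ℝ) = (s : ℝ))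
    (hlam_anti : ∀ i j, i < j → lam j < lam i)
    (f : GL (Fin n) F → ℂ) (hf : GLTrunc.IsKottwitzFunction ϖ n α s f)
    (fi : ∀ i : Fin c.length, GL (Fin (c.blocksFun i)) F → ℂ)
    (hfi : ∀ i, GLTrunc.IsKottwitzFunction ϖ (c.blocksFun i) α (si i) (fi i)) :
    (∀ d : Composition n, d ≠ c →
      GLTrunc.truncation d (GLTrunc.repeatVec c lam) f = fun _ => 0) ∧
    GLTrunc.IsHecke (GLTrunc.truncation c (GLTrunc.repeatVec c lam) f) ∧
    GLTrunc.truncation c (GLTrunc.repeatVec c lam) f = fun m =>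
      (((GLTrunc.resCard F : ℝ) ^ ((α : ℝ) * GLTrunc.constC c s si) : ℝ) : ℂ) *
        (GLTrunc.charCompact c m * ∏ i, fi i (m i)) := by
  classical
  have hlam : StrictAnti lam := fun i j hij => hlam_anti i j hij
  have hsi : ∑ i, si i = s := by
    have : ((∑ i, si i : ℕ) : ℝ) = s := by
      rw [← hlam_sum]
      push_cast
      exact Finset.sum_congr rfl fun i _ => (hlam_int i).symm
    exact_mod_cast this
  have hn : ∀ i, (c.blocksFun i : ℝ) ≠ 0 := fun i => by
    exact_mod_cast Nat.one_le_iff_ne_zero.1 (c.one_le_blocksFun i)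
  have hdet : ∀ (m : GLTrunc.Levi F c) i, (m i).val.det ≠ 0 := fun m i =>
    norm_pos_iff.1 (GLTrunc.norm_det_pos (m i))
  have hslope : ∀ (m : GLTrunc.Levi F c) i, GLTrunc.blockSlope c m i = α * lam i ↔
      ‖(m i).val.det‖ = ‖ϖ‖ ^ (α * si i) := fun m i => by
    rw [← GLTrunc.val_eq_natCast_iff hϖ (hdet m i), GLTrunc.blockSlope, div_eq_iff (hn i),
      mul_assoc, hlam_int]
    push_cast
    rfl
  have heq : GLTrunc.truncation c (GLTrunc.repeatVec c lam) f = fun m =>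
      (((GLTrunc.resCard F : ℝ) ^ ((α : ℝ) * GLTrunc.constC c s si) : ℝ) : ℂ) *
        (GLTrunc.charCompact c m * ∏ i, fi i (m i)) := by
    funext m
    rw [mul_left_comm, ← hf.constantTerm_eq hϖ hα c hsi hfi m]
    by_cases hm : m ∈ GLTrunc.compactElements F c
    · rw [GLTrunc.charCompact, Set.indicator_of_mem hm, Pi.one_apply, one_mul]
      split_ifs with hR
      · exact GLTrunc.truncation_of_mem hlam (by exact_mod_cast hα) hm
          fun i => (hslope m i).2 (hR i)
      -- `C_λ` fixes the slopes only up to the scale `t`. Comparing the valuation `αs` of the full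
      -- determinant on the support with `ts` gives `t = α`, because `s > 0`, and this contradicts
      -- the failure of the determinant conditions.
      · by_contra hne
        obtain ⟨-, -, hct, t, -, ht⟩ :=
          GLTrunc.exists_blockSlope_eq_of_truncation_ne_zero c c lam hne
        have ht' : ∀ i, GLTrunc.blockSlope c m i = t * lam i := fun i => by
          simpa using ht (c.embedding i ⟨0, c.one_le_blocksFun i⟩)
        have hprod := hf.norm_det_of_constantTerm_ne_zero hϖ hα c hct
        rw [← norm_prod, ← GLTrunc.val_eq_natCast_iff hϖ
          (Finset.prod_ne_zero_iff.2 fun i _ => hdet m i)] at hprod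
        have hsum : GLTrunc.val (∏ i, (m i).val.det) = t * s := by
          rw [GLTrunc.val, norm_prod, Real.logb_prod _ _ fun i _ =>
            (GLTrunc.norm_det_pos (m i)).ne', ← Finset.sum_neg_distrib, ← hlam_sum,
            Finset.mul_sum]
          refine Finset.sum_congr rfl fun i _ => ?_
          rw [← mul_assoc, ← ht' i, GLTrunc.blockSlope, div_mul_cancel₀ _ (hn i)]
          rfl
        have hs' : (s : ℝ) ≠ 0 := by exact_mod_cast hs.ne'
        have htα : t = α := by
          rw [hsum, Nat.cast_mul] at hprod
          exact mul_right_cancel₀ hs' hprod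
        exact hR fun i => (hslope m i).1 (by rw [ht' i, htα])
    · rw [GLTrunc.truncation, GLTrunc.charCompact, Set.indicator_of_notMem hm]
      simp
  refine ⟨fun d hd => GLTrunc.truncation_eq_zero_of_ne hd hlam, ?_, heq⟩
  rw [heq]
  exact GLTrunc.isHecke_charCompact_mul_prod c _ fun i => (hfi i).unramified.toIsHecke
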